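/- Let $k$ be an arbitrary field. A Kronecker module is a finite-dimensional right module over the path algebra of the Kronecker quiver over $k$, equivalently a finite-dimensional representation $V_1\leftleftarrows V_2$, i.e. two finite-dimensional $k$-vector spaces with two linear maps $a,b:V_2\to V_1$; its dimension vector is $(\dim_k V_1,\dim_k V_2)$. For $n\ge 0$ let $P_n$ be the preprojective indecomposable of dimension vector $(n+1,n)$, given by $k^{n+1}\leftleftarrows k^n$ with the matrices $\binom{E_n}{0}$ and $\binom{0}{E_n}$, where $E_n$ is the identity matrix, and let $I_n$ be the preinjective indecomposable of dimension vector $(n,n+1)$, given by the transposed matrices. An indecomposable Kronecker module is regular if it is isomorphic to no $P_n$ and to no $I_n$; a Kronecker module is regular if it is a finite direct sum of regular indecomposables. For a closed point $x$ of $\mathbb P^1_k$ and $t\ge 1$ let $R_x(t)$ be the regular indecomposable of regular length $t$ in the tube at $x$: if $x$ is the point of $\mathbb A^1_k=\operatorname{Spec} k[T]$ given by the maximal ideal $\mathfrak m$, then $V_1=V_2=k[T]/\mathfrak m^t$, $a$ is the identity and $b$ is multiplication by $T$; if $x=\infty$, then $V_1=V_2=k[T]/(T^t)$, $a$ is multiplication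 by $T$ and $b$ is the identity. Let $0\le n<m$ be integers and let $X$ be a Kronecker module. Then there is a short exact sequence $0\to P_n\to P_m\to X\to 0$ if and only if $X$ satisfies the following two conditions: (i) $X$ is a regular module with $\underline{\dim}\, X=\underline{\dim}\, P_m-\underline{\dim}\, P_n$; (ii) whenever $X$ is decomposed into a direct sum of indecomposables and two summands at different places of the decomposition are isomorphic to $R_x(t)$ and $R_{x'}(t')$ respectively, then $x\neq x'$ (that is, the indecomposable summands of $X$ lie in pairwise distinct tubes). -/

import Mathlib

open Polynomial Module

/-- A Kronecker module over `k`: a finite-dimensional representation of the Kronecker quiver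
`1 ⇇ 2`, that is, two finite-dimensional spaces and two linear maps from the space at vertex `2`
to the space at vertex `1`. -/
structure KroneckerModule.{u} (k : Type u) [Field k] where
  V₁ : Type u
  V₂ : Type u
  [addCommGroup₁ : AddCommGroup V₁]
  [addCommGroup₂ : AddCommGroup V₂]
  [module₁ : Module k V₁]
  [module₂ : Module k V₂]
  [finite₁ : Module.Finite k V₁]
  [finite₂ : Module.Finite k V₂]
  a : V₂ →ₗ[k] V₁
  b : V₂ →ₗ[k] V₁

namespace KroneckerModule

universe u

attribute [instance] addCommGroup₁ addCommGroup₂ module₁ module₂ finite₁ finite₂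

variable {k : Type u} [Field k]

/-- Morphisms of Kronecker modules. -/
@[ext]
structure Hom (M N : KroneckerModule k) where
  φ₁ : M.V₁ →ₗ[k] N.V₁
  φ₂ : M.V₂ →ₗ[k] N.V₂
  comm_a : φ₁ ∘ₗ M.a = N.a ∘ₗ φ₂
  comm_b : φ₁ ∘ₗ M.b = N.b ∘ₗ φ₂

/-- `M` and `N` are isomorphic: there are linear isomorphisms at the two vertices which commute
with the structure maps. -/
def IsIso (M N : KroneckerModule k) : Prop :=
  ∃ (e₁ : M.V₁ ≃ₗ[k] N.V₁) (e₂ : M.V₂ ≃ₗ[k] N.V₂),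
    (∀ v, e₁ (M.a v) = N.a (e₂ v)) ∧ ∀ v, e₁ (M.b v) = N.b (e₂ v)

/-- The sequence `0 → L → M → N → 0` given by `f` and `g` is exact. -/
def IsShortExact {L M N : KroneckerModule k} (f : Hom L M) (g : Hom M N) : Prop :=
  (Function.Injective f.φ₁ ∧ Function.Exact f.φ₁ g.φ₁ ∧ Function.Surjective g.φ₁) ∧
  (Function.Injective f.φ₂ ∧ Function.Exact f.φ₂ g.φ₂ ∧ Function.Surjective g.φ₂)

/-- The dimension vector, with integer entries so that differences can be formed. -/
noncomputable def dimVec (M : KroneckerModule k) : ℤ × ℤ :=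
  (finrank k M.V₁, finrank k M.V₂)

/-- The zero module. -/
def IsZero (M : KroneckerModule k) : Prop :=
  Subsingleton M.V₁ ∧ Subsingleton M.V₂

/-- The direct sum of two Kronecker modules. -/
def prod (M N : KroneckerModule k) : KroneckerModule k where
  V₁ := M.V₁ × N.V₁
  V₂ := M.V₂ × N.V₂
  a := LinearMap.prodMap M.a N.a
  b := LinearMap.prodMap M.b N.b

/-- The direct sum of a finite family of Kronecker modules. -/
def directSum {r : ℕ} (Y : Fin r → KroneckerModule k) : KroneckerModule k where
  V₁ := ∀ i, (Y i).V₁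
  V₂ := ∀ i, (Y i).V₂
  a := LinearMap.pi fun i => (Y i).a ∘ₗ LinearMap.proj i
  b := LinearMap.pi fun i => (Y i).b ∘ₗ LinearMap.proj i

/-- Indecomposable Kronecker modules. -/
def Indecomposable (M : KroneckerModule k) : Prop :=
  ¬ M.IsZero ∧ ∀ A B : KroneckerModule k, M.IsIso (A.prod B) → A.IsZero ∨ B.IsZero

/-- The `(n+1) × n` matrix with the identity in the first `n` rows and last row zero. -/
def upperBlock (k : Type u) [Field k] (n : ℕ) : Matrix (Fin (n + 1)) (Fin n) k :=
  Matrix.of fun i j => if i = j.castSucc then 1 else 0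

/-- The `(n+1) × n` matrix with first row zero and the identity in the last `n` rows. -/
def lowerBlock (k : Type u) [Field k] (n : ℕ) : Matrix (Fin (n + 1)) (Fin n) k :=
  Matrix.of fun i j => if i = j.succ then 1 else 0

/-- The preprojective indecomposable `Pₙ`, of dimension vector `(n + 1, n)`. -/
noncomputable def P (k : Type u) [Field k] (n : ℕ) : KroneckerModule k where
  V₁ := Fin (n + 1) → k
  V₂ := Fin n → k
  a := Matrix.toLin' (upperBlock k n)
  b := Matrix.toLin' (lowerBlock k n)

/-- The preinjective indecomposable `Iₙ`, of dimension vector `(n, n + 1)`. -/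
noncomputable def I (k : Type u) [Field k] (n : ℕ) : KroneckerModule k where
  V₁ := Fin n → k
  V₂ := Fin (n + 1) → k
  a := Matrix.toLin' (upperBlock k n).transpose
  b := Matrix.toLin' (lowerBlock k n).transpose

/-- Regular indecomposables: the indecomposables that are neither preprojective nor
preinjective. -/
def IsRegularIndecomposable (M : KroneckerModule k) : Prop :=
  M.Indecomposable ∧ (∀ n, ¬ M.IsIso (P k n)) ∧ ∀ n, ¬ M.IsIso (I k n)

/-- Regular modules: finite direct sums of regular indecomposables. -/
def IsRegular (M : KroneckerModule k) : Prop :=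
  ∃ (r : ℕ) (Y : Fin r → KroneckerModule k),
    (∀ i, (Y i).IsRegularIndecomposable) ∧ M.IsIso (directSum Y)

/-- The closed points of the projective line over `k`: those of the affine line `Spec k[X]`,
that is, the maximal ideals of `k[X]`, and the point at infinity. -/
inductive ClosedPoint (k : Type u) [Field k] : Type u
  | affine (𝔪 : MaximalSpectrum k[X])
  | infty

theorem finite_quotient_pow (𝔪 : Ideal k[X]) (h : 𝔪 ≠ ⊥) (t : ℕ) :
    Module.Finite k (k[X] ⧸ 𝔪 ^ t) := by
  obtain ⟨f, hf, hf0⟩ := Submodule.exists_mem_ne_zero_of_ne_bot (pow_ne_zero t h)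
  have h1 : Module.Finite k (k[X] ⧸ Ideal.span {f}) :=
    (AdjoinRoot.powerBasis hf0).finite
  have hle : Ideal.span {f} ≤ 𝔪 ^ t := (Ideal.span_singleton_le_iff_mem _).2 hf
  exact Module.Finite.of_surjective (Ideal.Quotient.factorₐ k hle).toLinearMap
    (Ideal.Quotient.factor_surjective hle)

theorem maximal_ne_bot (𝔪 : MaximalSpectrum k[X]) : 𝔪.asIdeal ≠ ⊥ :=
  Ring.ne_bot_of_isMaximal_of_not_isField 𝔪.isMaximal (Polynomial.not_isField k)

/-- The regular module `R_x(t)`, which for `t ≥ 1` is the indecomposable of regular length `t` in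
the tube at `x`. At the maximal ideal `𝔪` of `k[X]` both spaces are `k[X] ⧸ 𝔪 ^ t`, with structure
maps the identity and multiplication by `X`; at infinity both spaces are `k[X] ⧸ (X) ^ t`, with
structure maps multiplication by `X` and the identity. -/
noncomputable def R : ClosedPoint k → ℕ → KroneckerModule k
  | .affine 𝔪, t =>
    haveI := finite_quotient_pow 𝔪.asIdeal (maximal_ne_bot 𝔪) t
    { V₁ := k[X] ⧸ 𝔪.asIdeal ^ t
      V₂ := k[X] ⧸ 𝔪.asIdeal ^ t
      a := LinearMap.id
      b := LinearMap.mulLeft k (Ideal.Quotient.mk (𝔪.asIdeal ^ t) X) }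
  | .infty, t =>
    haveI := finite_quotient_pow (k := k) (Ideal.span {X})
      (by simp) t
    { V₁ := k[X] ⧸ (Ideal.span {X} : Ideal k[X]) ^ t
      V₂ := k[X] ⧸ (Ideal.span {X} : Ideal k[X]) ^ t
      a := LinearMap.mulLeft k (Ideal.Quotient.mk ((Ideal.span {X} : Ideal k[X]) ^ t) X)
      b := LinearMap.id }

/-- `M` is (isomorphic to) one of the indecomposables in the tube at `x`. -/
def InTube (x : ClosedPoint k) (M : KroneckerModule k) : Prop :=
  ∃ t : ℕ, 1 ≤ t ∧ M.IsIso (R x t)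

/-- Whenever `M` is decomposed into indecomposables, any two summands `R_x(t)` and `R_{x'}(t')` at
different places of the decomposition have `x ≠ x'`. -/
def SummandsInDistinctTubes (M : KroneckerModule k) : Prop :=
  ∀ (r : ℕ) (Y : Fin r → KroneckerModule k), (∀ i, (Y i).Indecomposable) →
    M.IsIso (directSum Y) →
    ∀ i j, i ≠ j → ∀ x x' : ClosedPoint k, InTube x (Y i) → InTube x' (Y j) → x ≠ x'

end KroneckerModule

/-!
Reading vectors as coefficients of polynomials turns `P_n` into the binary forms of degree `n` and
`n - 1`, with structure maps the multiplications by the two variables, and a morphism `P_n → P_m`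
into the multiplication by a form of degree `m - n`. By the Chinese remainder theorem the cokernel
of a nonzero form is the direct sum of the `R_x(t)` over its zeros `x`, including `∞`, with `t` the
multiplicity of `x`. Hence a cokernel is regular, and a regular module with summands in distinct
tubes is the cokernel of the product of the equations of its points.

For the latter one needs to know that the regular indecomposables which occur lie in tubes. An
indecomposable with `dim V₁ < dim V₂` is preinjective, by induction along the reflection functor;
so every summand of a regular module with `dim V₁ = dim V₂` again has `dim V₁ = dim V₂`. In an
indecomposable the increasing chain of the linear relation `a⁻¹b` splits off, so it is zero or
everything: `a` is injective or `b` is surjective. With equal dimensions one of them is bijective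
and the module is a module over `k[X]`.

The summands of a cokernel lie in distinct tubes because a morphism `P_m → R_x(t) ⊕ R_x(t')` is
`p ↦ (p c, p c')` for fixed `c` and `c'`, so that modulo the maximal ideal of `x` its image has rank
at most one over the residue field.
-/

section Splitting

variable {k V W : Type*} [Field k] [AddCommGroup V] [Module k V] [AddCommGroup W] [Module k W]

theorem exists_isProj (U : Submodule k V) :
    ∃ ρ : V →ₗ[k] V, LinearMap.IsProj U ρ := by
  obtain ⟨ρ, hρ⟩ := U.subtype.exists_leftInverse_of_injective U.ker_subtype
  exact ⟨U.subtype ∘ₗ ρ, fun v => (ρ v).2,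
    fun v hv => congrArg Subtype.val (LinearMap.congr_fun hρ ⟨v, hv⟩)⟩

theorem exists_map_eq_zero_and_sub_mem {K : Submodule k V} {L : Submodule k W} {a : V →ₗ[k] W}
    (h : L.comap a = K) :
    ∃ r : W →ₗ[k] V, (∀ w ∈ L, r w = 0) ∧ ∀ v, v - r (a v) ∈ K := by
  obtain ⟨r, hr⟩ := (K.mapQ L a h.ge).exists_leftInverse_of_injective (by
    rw [Submodule.ker_mapQ, h, Submodule.mkQ_map_self])
  obtain ⟨s, hs⟩ := K.mkQ.exists_rightInverse_of_surjective K.range_mkQ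
  refine ⟨s ∘ₗ r ∘ₗ L.mkQ, fun w hw => ?_, fun v => ?_⟩
  · simp [(Submodule.Quotient.mk_eq_zero L).2 hw]
  · have r_mk : r (L.mkQ (a v)) = K.mkQ v := LinearMap.congr_fun hr (K.mkQ v)
    have mk_s : K.mkQ (s (K.mkQ v)) = K.mkQ v := LinearMap.congr_fun hs (K.mkQ v)
    rw [← Submodule.Quotient.mk_eq_zero, ← Submodule.mkQ_apply, map_sub, LinearMap.comp_apply,
      LinearMap.comp_apply, r_mk, mk_s, sub_self]

end Splitting

section ExactSequences

variable {R A B C C' : Type*}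

theorem finrank_eq_add_finrank_range_of_exact [DivisionRing R] [AddCommGroup A] [Module R A]
    [AddCommGroup B] [Module R B] [AddCommGroup C] [Module R C] [Module.Finite R B]
    {f : A →ₗ[R] B} {g : B →ₗ[R] C} (hf : Function.Injective f) (hfg : Function.Exact f g) :
    finrank R B = finrank R A + finrank R (LinearMap.range g) := by
  rw [← LinearMap.finrank_range_add_finrank_ker g, hfg.linearMap_ker_eq,
    LinearMap.finrank_range_of_inj hf, add_comm]

theorem exists_linearEquiv_of_exact [Ring R] [AddCommGroup A] [Module R A] [AddCommGroup B]
    [Module R B] [AddCommGroup C] [Module R C] [AddCommGroup C'] [Module R C'] {f : A →ₗ[R] B}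
    {g : B →ₗ[R] C} {g' : B →ₗ[R] C'} (hfg : Function.Exact f g) (hg : Function.Surjective g)
    (hfg' : Function.Exact f g') (hg' : Function.Surjective g') :
    ∃ e : C ≃ₗ[R] C', ∀ v, e (g v) = g' v := by
  refine ⟨(hfg.linearEquivOfSurjective hg).symm.trans (hfg'.linearEquivOfSurjective hg'),
    fun v => ?_⟩
  rw [LinearEquiv.trans_apply, Function.Exact.linearEquivOfSurjective_symm_apply]
  rfl

end ExactSequences

theorem map_smul_of_map_X_smul {k V W : Type*} [CommSemiring k] [AddCommGroup V] [Module k V]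
    [Module k[X] V] [IsScalarTower k k[X] V] [AddCommGroup W] [Module k W] [Module k[X] W]
    [IsScalarTower k k[X] W] (f : V →ₗ[k] W) (h : ∀ v, f ((X : k[X]) • v) = (X : k[X]) • f v)
    (q : k[X]) (v : V) : f (q • v) = q • f v := by
  induction q using Polynomial.induction_on with
  | C c => rw [← mul_one (C c), ← smul_eq_C_mul, smul_assoc, one_smul, map_smul, smul_assoc,
      one_smul]
  | add p q hp hq => rw [add_smul, map_add, hp, hq, add_smul]
  | monomial n c ih => rw [pow_succ', mul_left_comm, mul_smul, h, ih, ← mul_smul]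

theorem exists_linearEquiv_of_directSum {A W ι : Type*} [Ring A] [AddCommGroup W] [Module A W]
    [Nontrivial W] {N : ι → Type*} [∀ i, AddCommGroup (N i)] [∀ i, Module A (N i)]
    (hW : ∀ e : Module.End A W, IsIdempotentElem e → e = 0 ∨ e = 1)
    (Φ : W ≃ₗ[A] DirectSum ι N) :
    ∃ i, Nontrivial (N i) ∧ Nonempty (W ≃ₗ[A] N i) := by
  classical
  obtain ⟨i, hi⟩ : ∃ i, Nontrivial (N i) := by
    by_contra! h
    exact not_subsingleton W (Φ.toEquiv.subsingleton_congr.2 ⟨fun x y => DFinsupp.ext fun i =>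
      Subsingleton.elim _ _⟩)
  let incl : N i →ₗ[A] W := Φ.symm.toLinearMap ∘ₗ DirectSum.lof A ι N i
  let proj : W →ₗ[A] N i := DirectSum.component A ι N i ∘ₗ Φ.toLinearMap
  have proj_incl : proj ∘ₗ incl = LinearMap.id := LinearMap.ext fun x => by
    simp [proj, incl, DirectSum.component.lof_self]
  have h_idem : IsIdempotentElem (incl ∘ₗ proj : Module.End A W) := by
    change incl ∘ₗ (proj ∘ₗ incl) ∘ₗ proj = incl ∘ₗ proj
    rw [proj_incl, LinearMap.id_comp]
  have h_ne_zero : incl ∘ₗ proj ≠ 0 := fun h0 => by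
    obtain ⟨x, hx⟩ := exists_ne (0 : N i)
    have proj_incl_apply (y) : proj (incl y) = y := LinearMap.congr_fun proj_incl y
    apply hx
    rw [← proj_incl_apply x, ← proj_incl_apply (proj _)]
    exact (congrArg proj (LinearMap.congr_fun h0 (incl x))).trans (map_zero proj)
  have incl_proj : incl ∘ₗ proj = LinearMap.id := (hW _ h_idem).resolve_left h_ne_zero
  exact ⟨i, hi, ⟨LinearEquiv.ofLinearMap proj incl proj_incl incl_proj⟩⟩

theorem exists_linearEquiv_quotient_span_pow {A W : Type*} [CommRing A] [IsDomain A]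
    [IsPrincipalIdealRing A] [AddCommGroup W] [Module A W] [Module.Finite A W] [Nontrivial W]
    (h_tors : Module.IsTorsion A W)
    (hW : ∀ e : Module.End A W, IsIdempotentElem e → e = 0 ∨ e = 1) :
    ∃ (p : A) (t : ℕ), Irreducible p ∧ t ≠ 0 ∧ Nonempty (W ≃ₗ[A] A ⧸ Ideal.span {p} ^ t) := by
  obtain ⟨ι, _, p, hp, t, ⟨Φ⟩⟩ := Module.equiv_directSum_of_isTorsion h_tors
  obtain ⟨i, hi, ⟨Ψ⟩⟩ := exists_linearEquiv_of_directSum hW Φ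
  refine ⟨p i, t i, hp i, fun ht => ?_, ⟨Ψ.trans (Submodule.quotEquivOfEq _ _ ?_)⟩⟩
  · rw [ht, pow_zero, ← Ideal.span, Ideal.span_singleton_one] at hi
    exact not_subsingleton _ (Ideal.Quotient.subsingleton_iff.2 rfl : Subsingleton (A ⧸ ⊤))
  · exact (Ideal.span_singleton_pow _ _).symm

theorem quotient_pow_eq_zero_or_eq_one_of_isIdempotentElem {A : Type*} [CommRing A] {𝔪 : Ideal A}
    [𝔪.IsMaximal] {t : ℕ} {c : A ⧸ 𝔪 ^ t} (hc : IsIdempotentElem c) : c = 0 ∨ c = 1 := by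
  obtain ⟨c, rfl⟩ := Ideal.Quotient.mk_surjective c
  by_cases hcm : c ∈ 𝔪
  · have h_notMem : 1 - c ∉ 𝔪 := fun h =>
      ‹𝔪.IsMaximal›.ne_top ((Ideal.eq_top_iff_one _).2 (by simpa using add_mem h hcm))
    have h_one := (IsIdempotentElem.iff_eq_one_of_isUnit
      (Ideal.Quotient.isUnit_mk_pow_of_notMem 𝔪 (n := t) h_notMem)).1
      (by simpa using hc)
    left
    simpa using h_one
  · exact .inr ((IsIdempotentElem.iff_eq_one_of_isUnit
      (Ideal.Quotient.isUnit_mk_pow_of_notMem _ hcm)).1 hc)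

theorem end_quotient_pow_eq_zero_or_eq_one_of_isIdempotentElem {A : Type*} [CommRing A]
    {𝔪 : Ideal A} [𝔪.IsMaximal] {t : ℕ} {e : Module.End A (A ⧸ 𝔪 ^ t)} (he : IsIdempotentElem e) :
    e = 0 ∨ e = 1 := by
  have e_apply : ∀ x, e x = e 1 * x := fun x => by
    obtain ⟨x, rfl⟩ := Ideal.Quotient.mk_surjective x
    have : Ideal.Quotient.mk (𝔪 ^ t) x = x • (1 : A ⧸ 𝔪 ^ t) := by
      simp [Algebra.smul_def]
    rw [this, map_smul, mul_smul_comm, mul_one]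
  have h_idem : IsIdempotentElem (e 1) := by
    rw [IsIdempotentElem, ← e_apply]
    exact LinearMap.congr_fun he 1
  refine (quotient_pow_eq_zero_or_eq_one_of_isIdempotentElem h_idem).imp ?_ ?_
  · exact fun h => LinearMap.ext fun x => by rw [e_apply, h, zero_mul, LinearMap.zero_apply]
  · exact fun h => LinearMap.ext fun x => by rw [e_apply, h, one_mul, Module.End.one_apply]

section RelationChain

variable {A Q V W : Type*} [Ring A] [AddCommGroup Q] [Module A Q] [AddCommGroup V] [Module A V]
  [AddCommGroup W] [Module A W] (a b : V →ₗ[A] W)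

/-- The increasing chain `0 ⊆ a⁻¹(b 0) ⊆ a⁻¹(b a⁻¹(b 0)) ⊆ ⋯` of the linear relation `a⁻¹b`. -/
def relChain : ℕ → Submodule A V
  | 0 => ⊥
  | i + 1 => ((relChain i).map b).comap a

theorem monotone_relChain : Monotone (relChain a b) := by
  refine monotone_nat_of_le_succ fun i => ?_
  induction i with
  | zero => exact bot_le
  | succ i ih => exact Submodule.comap_mono (Submodule.map_mono ih)

theorem exists_relChain_succ_eq [IsNoetherian A V] : ∃ s, relChain a b (s + 1) = relChain a b s :=
  let ⟨s, hs⟩ := WellFoundedGT.monotone_chain_condition ⟨relChain a b, monotone_relChain a b⟩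
  ⟨s, (hs (s + 1) s.le_succ).symm⟩

theorem exists_b_comp_sub_a_comp_comp_eq [Module.Projective A Q] (c : Q →ₗ[A] Q) (i : ℕ)
    (γ : Q →ₗ[A] W) (hγ : ∀ q, γ q ∈ (relChain a b i).map b) :
    ∃ φ : Q →ₗ[A] V, (∀ q, φ q ∈ relChain a b i) ∧ ∀ q, b (φ q) - a (φ (c q)) = γ q := by
  induction i generalizing γ with
  | zero =>
    have γ_eq_zero : ∀ q, γ q = 0 := by simpa [relChain] using hγ
    exact ⟨0, fun _ => Submodule.zero_mem _, fun q => by simp [γ_eq_zero]⟩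
  | succ i ih =>
    obtain ⟨ψ, hψ⟩ := Module.projective_lifting_property (b.submoduleMap (relChain a b (i + 1)))
      (γ.codRestrict _ hγ) (b.submoduleMap_surjective _)
    have b_ψ (q) : b (ψ q) = γ q := congrArg Subtype.val (LinearMap.congr_fun hψ q)
    obtain ⟨φ, hφ, φ_eq⟩ := ih (a ∘ₗ Submodule.subtype _ ∘ₗ ψ ∘ₗ c) fun q => (ψ (c q)).2
    refine ⟨Submodule.subtype _ ∘ₗ ψ + φ,
      fun q => add_mem (ψ q).2 (monotone_relChain a b i.le_succ (hφ q)), fun q => ?_⟩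
    have := φ_eq q
    simp only [LinearMap.comp_apply, Submodule.subtype_apply, LinearMap.add_apply, map_add]
      at this ⊢
    rw [b_ψ, add_sub_add_comm, this, sub_add_cancel]

end RelationChain

theorem not_surjective_smul_quotient_pow_prod {A : Type*} [CommRing A] {𝔪 : Ideal A} [𝔪.IsPrime]
    {s t : ℕ} (hs : s ≠ 0) (ht : t ≠ 0) (c : A ⧸ 𝔪 ^ s) (d : A ⧸ 𝔪 ^ t) :
    ¬ Function.Surjective fun r : A => (r • c, r • d) := by
  intro h
  obtain ⟨c, rfl⟩ := Ideal.Quotient.mk_surjective c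
  obtain ⟨d, rfl⟩ := Ideal.Quotient.mk_surjective d
  have exists_mul_sub_mem (p q : A) : ∃ r, r * c - p ∈ 𝔪 ∧ r * d - q ∈ 𝔪 := by
    obtain ⟨r, hr⟩ := h (Ideal.Quotient.mk _ p, Ideal.Quotient.mk _ q)
    exact ⟨r, Ideal.pow_le_self hs (Ideal.Quotient.eq.1 (congrArg Prod.fst hr)),
      Ideal.pow_le_self ht (Ideal.Quotient.eq.1 (congrArg Prod.snd hr))⟩
  have one_notMem : (1 : A) ∉ 𝔪 := 𝔪.one_notMem
  obtain ⟨r, hrc, hrd⟩ := exists_mul_sub_mem 1 0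
  obtain ⟨s, -, hsd⟩ := exists_mul_sub_mem 0 1
  rcases ‹𝔪.IsPrime›.mem_or_mem (sub_zero (r * d) ▸ hrd) with hr | hd
  · exact one_notMem (by simpa using sub_mem (𝔪.mul_mem_right c hr) hrc)
  · exact one_notMem (by simpa using sub_mem (𝔪.mul_mem_left s hd) hsd)

section CoefficientVectors

variable {k : Type*} [Field k] {m n : ℕ}

/-- The polynomial of degree less than `n` with a given vector of coefficients. This is
`Polynomial.ofFn` without decidable equality. -/
noncomputable def toPoly (n : ℕ) : (Fin n → k) →ₗ[k] k[X] :=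
  (degreeLT k n).subtype ∘ₗ (degreeLTEquiv k n).symm.toLinearMap

theorem toPoly_apply (v : Fin n → k) : toPoly n v = ∑ i : Fin n, monomial (i : ℕ) (v i) :=
  rfl

theorem toPoly_mem_degreeLT (v : Fin n → k) : toPoly n v ∈ degreeLT k n :=
  ((degreeLTEquiv k n).symm v).2

theorem coeff_toPoly (v : Fin n → k) (i : Fin n) : (toPoly n v).coeff i = v i :=
  congrFun ((degreeLTEquiv k n).apply_symm_apply v) i

theorem toPoly_injective (n : ℕ) : Function.Injective (toPoly n : (Fin n → k) →ₗ[k] k[X]) :=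
  fun v w h => funext fun i => by rw [← coeff_toPoly v, h, coeff_toPoly]

theorem exists_toPoly_eq {q : k[X]} (hq : q ∈ degreeLT k n) : ∃ v, toPoly n v = q :=
  ⟨degreeLTEquiv k n ⟨q, hq⟩, by simp [toPoly]⟩

theorem toPoly_single (i : Fin n) : toPoly n (Pi.single i (1 : k)) = X ^ (i : ℕ) := by
  rw [toPoly_apply, Finset.sum_eq_single_of_mem i (Finset.mem_univ i) fun j _ hj => by simp [hj],
    Pi.single_eq_same, X_pow_eq_monomial]

theorem forall_coeff_toPoly_eq_zero_iff {p : ℕ → Prop} {v : Fin n → k} :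
    (∀ j, p j → (toPoly n v).coeff j = 0) ↔ ∀ i : Fin n, p i → v i = 0 := by
  refine ⟨fun h i hi => coeff_toPoly v i ▸ h i hi, fun h j hj => ?_⟩
  rcases lt_or_ge j n with hjn | hjn
  · exact (coeff_toPoly v ⟨j, hjn⟩).trans (h ⟨j, hjn⟩ hj)
  · exact coeff_eq_zero_of_degree_lt
      ((mem_degreeLT.1 (toPoly_mem_degreeLT v)).trans_le (Nat.cast_le.2 hjn))

theorem X_pow_dvd_toPoly_rev_iff {t : ℕ} {v : Fin n → k} :
    X ^ t ∣ toPoly n (v ∘ Fin.rev) ↔ toPoly n v ∈ degreeLT k (n - t) := by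
  rw [X_pow_dvd_iff, mem_degreeLT, degree_lt_iff_coeff_zero,
    forall_coeff_toPoly_eq_zero_iff (p := (· < t)), forall_coeff_toPoly_eq_zero_iff,
    ← Fin.revPerm.forall_congr_right]
  refine forall_congr' fun i => ?_
  rw [Fin.revPerm_apply, Function.comp_apply, Fin.rev_rev, Fin.val_rev]
  exact imp_congr_left (by omega)

theorem mul_mem_degreeLT_iff {F : k[X]} (hF : F ≠ 0) {n : ℕ} {q : k[X]} :
    F * q ∈ degreeLT k (n + F.natDegree) ↔ q ∈ degreeLT k n := by
  by_cases hq : q = 0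
  · simp [hq]
  · rw [mem_degreeLT, mem_degreeLT, degree_eq_natDegree hq, degree_eq_natDegree (mul_ne_zero hF hq),
      natDegree_mul hF hq, Nat.cast_lt, Nat.cast_lt]
    omega

theorem exists_linearMap_toPoly_eq_mul {F : k[X]} (h : n + F.natDegree ≤ m) :
    ∃ f : (Fin n → k) →ₗ[k] (Fin m → k), ∀ v, toPoly m (f v) = F * toPoly n v := by
  have mul_mem (v : Fin n → k) : F * toPoly n v ∈ degreeLT k m := by
    refine mem_degreeLT.2 ((degree_mul_le _ _).trans_lt ?_)
    refine (add_le_add_left degree_le_natDegree _).trans_lt ?_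
    refine (WithBot.add_lt_add_left (by simp) (mem_degreeLT.1 (toPoly_mem_degreeLT v))).trans_le ?_
    exact_mod_cast (add_comm _ _).trans_le h
  exact ⟨degreeLTEquiv k m ∘ₗ (LinearMap.mulLeft k F ∘ₗ toPoly n).codRestrict _ mul_mem,
    fun v => by simp [toPoly]⟩

theorem add_natDegree_le_of_toPoly_eq_mul {F : k[X]} (hF : F ≠ 0)
    {f : (Fin (n + 1) → k) → (Fin (m + 1) → k)}
    (hf : ∀ v, toPoly (m + 1) (f v) = F * toPoly (n + 1) v) : n + F.natDegree ≤ m := by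
  have h_mem := toPoly_mem_degreeLT (f (Pi.single (Fin.last n) 1))
  rw [hf, toPoly_single, Fin.val_last, mem_degreeLT, degree_eq_natDegree
    (mul_ne_zero hF (pow_ne_zero n X_ne_zero)), natDegree_mul_X_pow n hF, Nat.cast_lt] at h_mem
  omega

end CoefficientVectors

namespace KroneckerModule

universe u

section Morphisms

variable {k : Type u} [Field k] {L M N : KroneckerModule k}

instance : Zero (Hom M N) where
  zero := ⟨0, 0, by simp, by simp⟩

/-- The identity morphism. -/
def Hom.id (M : KroneckerModule k) : Hom M M where
  φ₁ := LinearMap.id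
  φ₂ := LinearMap.id
  comm_a := rfl
  comm_b := rfl

/-- The composite of two morphisms. -/
def Hom.comp (g : Hom M N) (f : Hom L M) : Hom L N where
  φ₁ := g.φ₁ ∘ₗ f.φ₁
  φ₂ := g.φ₂ ∘ₗ f.φ₂
  comm_a := by rw [LinearMap.comp_assoc, f.comm_a, ← LinearMap.comp_assoc, g.comm_a,
    LinearMap.comp_assoc]
  comm_b := by rw [LinearMap.comp_assoc, f.comm_b, ← LinearMap.comp_assoc, g.comm_b,
    LinearMap.comp_assoc]

theorem Hom.a_apply (f : Hom M N) (v : M.V₂) : f.φ₁ (M.a v) = N.a (f.φ₂ v) :=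
  LinearMap.congr_fun f.comm_a v

theorem Hom.b_apply (f : Hom M N) (v : M.V₂) : f.φ₁ (M.b v) = N.b (f.φ₂ v) :=
  LinearMap.congr_fun f.comm_b v

/-- The morphism to a direct sum with the given components. -/
def Hom.pi {r : ℕ} {Y : Fin r → KroneckerModule k} (f : ∀ i, Hom M (Y i)) :
    Hom M (directSum Y) where
  φ₁ := LinearMap.pi fun i => (f i).φ₁
  φ₂ := LinearMap.pi fun i => (f i).φ₂
  comm_a := LinearMap.ext fun v => funext fun i => (f i).a_apply v
  comm_b := LinearMap.ext fun v => funext fun i => (f i).b_apply v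

/-- The projection of a direct sum onto one of its summands. -/
def Hom.proj {r : ℕ} (Y : Fin r → KroneckerModule k) (i : Fin r) : Hom (directSum Y) (Y i) where
  φ₁ := LinearMap.proj i
  φ₂ := LinearMap.proj i
  comm_a := rfl
  comm_b := rfl

theorem IsIso.exists_hom (h : M.IsIso N) :
    ∃ (f : Hom M N) (g : Hom N M), g.comp f = Hom.id M ∧ f.comp g = Hom.id N := by
  obtain ⟨e₁, e₂, ha, hb⟩ := h
  refine ⟨⟨e₁, e₂, LinearMap.ext ha, LinearMap.ext hb⟩,
    ⟨e₁.symm, e₂.symm, LinearMap.ext fun v => ?_, LinearMap.ext fun v => ?_⟩,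
    Hom.ext e₁.symm_comp e₂.symm_comp, Hom.ext e₁.comp_symm e₂.comp_symm⟩
  · simp [LinearEquiv.symm_apply_eq, ha]
  · simp [LinearEquiv.symm_apply_eq, hb]

theorem IsIso.symm (h : M.IsIso N) : N.IsIso M := by
  obtain ⟨e₁, e₂, ha, hb⟩ := h
  refine ⟨e₁.symm, e₂.symm, fun v => ?_, fun v => ?_⟩
  · rw [LinearEquiv.symm_apply_eq, ha, LinearEquiv.apply_symm_apply]
  · rw [LinearEquiv.symm_apply_eq, hb, LinearEquiv.apply_symm_apply]

theorem IsIso.trans (h : L.IsIso M) (h' : M.IsIso N) : L.IsIso N := by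
  obtain ⟨e₁, e₂, ha, hb⟩ := h
  obtain ⟨f₁, f₂, ha', hb'⟩ := h'
  exact ⟨e₁.trans f₁, e₂.trans f₂, fun v => by simp [ha, ha'], fun v => by simp [hb, hb']⟩

theorem IsIso.finrank₁ (h : M.IsIso N) : finrank k M.V₁ = finrank k N.V₁ :=
  let ⟨e₁, _⟩ := h
  e₁.finrank_eq

theorem IsIso.finrank₂ (h : M.IsIso N) : finrank k M.V₂ = finrank k N.V₂ :=
  let ⟨_, e₂, _⟩ := h
  e₂.finrank_eq

theorem IsIso.directSum {r : ℕ} {Y Z : Fin r → KroneckerModule k} (h : ∀ i, (Y i).IsIso (Z i)) :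
    (directSum Y).IsIso (directSum Z) := by
  choose e₁ e₂ ha hb using h
  exact ⟨LinearEquiv.piCongrRight e₁, LinearEquiv.piCongrRight e₂,
    fun v => funext fun i => ha i (v i), fun v => funext fun i => hb i (v i)⟩

/-- The Kronecker module with its two structure maps interchanged. -/
def swap (M : KroneckerModule k) : KroneckerModule k where
  V₁ := M.V₁
  V₂ := M.V₂
  a := M.b
  b := M.a

/-- A morphism, seen as a morphism between the modules with interchanged structure maps. -/
def Hom.swap (f : Hom M N) : Hom M.swap N.swap where
  φ₁ := f.φ₁
  φ₂ := f.φ₂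
  comm_a := f.comm_b
  comm_b := f.comm_a

theorem IsIso.swap : M.IsIso N → M.swap.IsIso N.swap
  | ⟨e₁, e₂, ha, hb⟩ => ⟨e₁, e₂, hb, ha⟩

end Morphisms

section Indecomposables

variable {k : Type u} [Field k] {M : KroneckerModule k}

/-- The submodule of a Kronecker module given by subspaces at the two vertices that are
compatible with both structure maps. -/
def sub (M : KroneckerModule k) (U₁ : Submodule k M.V₁) (U₂ : Submodule k M.V₂)
    (ha : ∀ v ∈ U₂, M.a v ∈ U₁) (hb : ∀ v ∈ U₂, M.b v ∈ U₁) : KroneckerModule k where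
  V₁ := U₁
  V₂ := U₂
  a := M.a.restrict ha
  b := M.b.restrict hb

theorem isIso_prod_sub {U₁ W₁ : Submodule k M.V₁} {U₂ W₂ : Submodule k M.V₂}
    (h₁ : IsCompl U₁ W₁) (h₂ : IsCompl U₂ W₂)
    (ha : ∀ v ∈ U₂, M.a v ∈ U₁) (hb : ∀ v ∈ U₂, M.b v ∈ U₁)
    (ha' : ∀ v ∈ W₂, M.a v ∈ W₁) (hb' : ∀ v ∈ W₂, M.b v ∈ W₁) :
    M.IsIso ((M.sub U₁ U₂ ha hb).prod (M.sub W₁ W₂ ha' hb')) :=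
  IsIso.symm ⟨Submodule.prodEquivOfIsCompl _ _ h₁, Submodule.prodEquivOfIsCompl _ _ h₂,
    fun v => (map_add M.a (U₂.subtype v.1) (W₂.subtype v.2)).symm,
    fun v => (map_add M.b (U₂.subtype v.1) (W₂.subtype v.2)).symm⟩

theorem Indecomposable.eq_bot_or_eq_top (h : M.Indecomposable) {U₁ : Submodule k M.V₁}
    {U₂ : Submodule k M.V₂} (e : Hom M M) (h₁ : LinearMap.IsProj U₁ e.φ₁)
    (h₂ : LinearMap.IsProj U₂ e.φ₂) : (U₁ = ⊥ ∧ U₂ = ⊥) ∨ (U₁ = ⊤ ∧ U₂ = ⊤) := by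
  have ha : ∀ v ∈ U₂, M.a v ∈ U₁ := fun v hv => by
    rw [← h₂.map_id v hv, ← e.a_apply]
    exact h₁.map_mem _
  have hb : ∀ v ∈ U₂, M.b v ∈ U₁ := fun v hv => by
    rw [← h₂.map_id v hv, ← e.b_apply]
    exact h₁.map_mem _
  have ha' : ∀ v ∈ LinearMap.ker e.φ₂, M.a v ∈ LinearMap.ker e.φ₁ := fun v hv => by
    rw [LinearMap.mem_ker] at hv ⊢
    rw [e.a_apply, hv, map_zero]
  have hb' : ∀ v ∈ LinearMap.ker e.φ₂, M.b v ∈ LinearMap.ker e.φ₁ := fun v hv => by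
    rw [LinearMap.mem_ker] at hv ⊢
    rw [e.b_apply, hv, map_zero]
  refine (h.2 _ _ (isIso_prod_sub h₁.isCompl h₂.isCompl ha hb ha' hb')).imp ?_ ?_
  · rintro ⟨s₁, s₂⟩
    exact ⟨Submodule.subsingleton_iff_eq_bot.1 s₁, Submodule.subsingleton_iff_eq_bot.1 s₂⟩
  · rintro ⟨s₁, s₂⟩
    have ker_eq_bot₁ : LinearMap.ker e.φ₁ = ⊥ := Submodule.subsingleton_iff_eq_bot.1 s₁
    have ker_eq_bot₂ : LinearMap.ker e.φ₂ = ⊥ := Submodule.subsingleton_iff_eq_bot.1 s₂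
    exact ⟨eq_top_of_isCompl_bot (ker_eq_bot₁ ▸ h₁.isCompl),
      eq_top_of_isCompl_bot (ker_eq_bot₂ ▸ h₂.isCompl)⟩

theorem isZero_or_isZero_of_isIso_prod {A B : KroneckerModule k} (h : M.IsIso (A.prod B))
    (hM : ∀ e : Hom M M, e.comp e = e → e = 0 ∨ e = Hom.id M) : A.IsZero ∨ B.IsZero := by
  obtain ⟨f, g, -, hfg⟩ := h.exists_hom
  let p : Hom (A.prod B) (A.prod B) :=
    ⟨LinearMap.inl k _ _ ∘ₗ LinearMap.fst k A.V₁ B.V₁,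
      LinearMap.inl k _ _ ∘ₗ LinearMap.fst k A.V₂ B.V₂,
      LinearMap.ext fun v => Prod.ext rfl (map_zero B.a).symm,
      LinearMap.ext fun v => Prod.ext rfl (map_zero B.b).symm⟩
  let e : Hom M M := g.comp (p.comp f)
  have p_eq : p = f.comp (e.comp g) := calc
    p = (Hom.id _).comp (p.comp (Hom.id _)) := rfl
    _ = f.comp (e.comp g) := by rw [← hfg]; rfl
  have he : e.comp e = e := calc
    e.comp e = g.comp (p.comp ((f.comp g).comp (p.comp f))) := rfl
    _ = e := by rw [hfg]; rfl
  rcases hM e he with he | he <;> rw [he] at p_eq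
  · have p_eq_zero : p = 0 := p_eq.trans
      (Hom.ext (LinearMap.ext fun _ => map_zero f.φ₁) (LinearMap.ext fun _ => map_zero f.φ₂))
    exact .inl ⟨subsingleton_of_forall_eq 0 fun x => congrArg Prod.fst
        (LinearMap.congr_fun (congrArg Hom.φ₁ p_eq_zero) (x, 0)),
      subsingleton_of_forall_eq 0 fun x => congrArg Prod.fst
        (LinearMap.congr_fun (congrArg Hom.φ₂ p_eq_zero) (x, 0))⟩
  · have p_eq_id : p = Hom.id _ := p_eq.trans hfg
    exact .inr ⟨subsingleton_of_forall_eq 0 fun y => congrArg Prod.snd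
        (LinearMap.congr_fun (congrArg Hom.φ₁ p_eq_id) (0, y)).symm,
      subsingleton_of_forall_eq 0 fun y => congrArg Prod.snd
        (LinearMap.congr_fun (congrArg Hom.φ₂ p_eq_id) (0, y)).symm⟩

theorem indecomposable_iff : M.Indecomposable ↔
    ¬ M.IsZero ∧ ∀ e : Hom M M, e.comp e = e → e = 0 ∨ e = Hom.id M := by
  refine ⟨fun h => ⟨h.1, fun e he => ?_⟩,
    fun ⟨h0, h⟩ => ⟨h0, fun A B hAB => isZero_or_isZero_of_isIso_prod hAB h⟩⟩
  have h₁ := LinearMap.IsIdempotentElem.isProj_range e.φ₁ (congrArg Hom.φ₁ he)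
  have h₂ := LinearMap.IsIdempotentElem.isProj_range e.φ₂ (congrArg Hom.φ₂ he)
  refine (h.eq_bot_or_eq_top e h₁ h₂).imp ?_ ?_
  · exact fun ⟨hU₁, hU₂⟩ =>
      Hom.ext (LinearMap.range_eq_bot.1 hU₁) (LinearMap.range_eq_bot.1 hU₂)
  · exact fun ⟨hU₁, hU₂⟩ =>
      Hom.ext (h₁.submodule_eq_top_iff.1 hU₁) (h₂.submodule_eq_top_iff.1 hU₂)

theorem Indecomposable.of_isIso {M N : KroneckerModule k} (h : M.Indecomposable)
    (hMN : M.IsIso N) : N.Indecomposable := by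
  refine ⟨fun ⟨h₁, h₂⟩ => ?_, fun A B hN => h.2 A B (hMN.trans hN)⟩
  obtain ⟨e₁, e₂, -⟩ := hMN
  exact h.1 ⟨e₁.toEquiv.subsingleton, e₂.toEquiv.subsingleton⟩

theorem Indecomposable.swap (h : M.Indecomposable) : M.swap.Indecomposable := by
  rw [indecomposable_iff] at h ⊢
  refine ⟨h.1, fun e he => ?_⟩
  have he' : (e.swap : Hom M M).comp e.swap = e.swap := congrArg Hom.swap he
  exact (h.2 e.swap he').imp (congrArg Hom.swap) (congrArg Hom.swap)

end Indecomposables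

section PolynomialModules

variable {k : Type u} [Field k] {V W : Type u}
  [AddCommGroup V] [Module k V] [Module.Finite k V] [Module k[X] V] [IsScalarTower k k[X] V]
  [AddCommGroup W] [Module k W] [Module.Finite k W] [Module k[X] W] [IsScalarTower k k[X] W]

/-- The Kronecker module given by the identity and the multiplication by `X` on a `k[X]`-module
that is finite-dimensional over `k`. -/
noncomputable abbrev ofModule (k : Type u) [Field k] (W : Type u) [AddCommGroup W] [Module k W]
    [Module.Finite k W] [Module k[X] W] [IsScalarTower k k[X] W] : KroneckerModule k where
  V₁ := W
  V₂ := W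
  a := LinearMap.id
  b := Algebra.lsmul k k W (X : k[X])

/-- `ofModule` is fully faithful. -/
noncomputable def ofModuleHomEquiv : (V →ₗ[k[X]] W) ≃ Hom (ofModule k V) (ofModule k W) where
  toFun f := ⟨f.restrictScalars k, f.restrictScalars k, rfl, LinearMap.ext fun v => f.map_smul X v⟩
  invFun f :=
    { toFun := f.φ₁
      map_add' := f.φ₁.map_add
      map_smul' := map_smul_of_map_X_smul f.φ₁ fun v =>
        (f.b_apply v).trans (congrArg (fun w : W => (X : k[X]) • w) (f.a_apply v).symm) }
  left_inv _ := rfl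
  right_inv f := Hom.ext rfl f.comm_a

theorem isIso_ofModule (f : V ≃ₗ[k[X]] W) : (ofModule k V).IsIso (ofModule k W) :=
  ⟨f.restrictScalars k, f.restrictScalars k, fun _ => rfl, f.map_smul X⟩

theorem indecomposable_ofModule_iff : (ofModule k W).Indecomposable ↔
    Nontrivial W ∧ ∀ e : Module.End k[X] W, IsIdempotentElem e → e = 0 ∨ e = 1 := by
  rw [indecomposable_iff, IsZero, and_self_iff, not_subsingleton_iff_nontrivial]
  refine and_congr_right fun _ => (Equiv.forall_congr ofModuleHomEquiv fun e => ?_).symm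
  have map_zero : ofModuleHomEquiv (k := k) (0 : Module.End k[X] W) = 0 := rfl
  have map_one : ofModuleHomEquiv (1 : Module.End k[X] W) = Hom.id (ofModule k W) := rfl
  have map_mul : (ofModuleHomEquiv e).comp (ofModuleHomEquiv e) =
      ofModuleHomEquiv (k := k) (e * e) := rfl
  rw [map_mul, ← map_zero, ← map_one, ofModuleHomEquiv.apply_eq_iff_eq,
    ofModuleHomEquiv.apply_eq_iff_eq, ofModuleHomEquiv.apply_eq_iff_eq, IsIdempotentElem]

theorem isIso_ofModule_of_bijective {M : KroneckerModule k} (ha : Function.Bijective M.a) :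
    M.IsIso (ofModule k (AEval' (M.b ∘ₗ (LinearEquiv.ofBijective M.a ha).symm.toLinearMap))) := by
  let α := LinearEquiv.ofBijective M.a ha
  refine ⟨AEval'.of _, α.trans (AEval'.of _), fun v => rfl, fun v => ?_⟩
  have : M.b (α.symm (α v)) = M.b v := by rw [α.symm_apply_apply]
  exact (congrArg (AEval'.of _) this.symm).trans (AEval'.X_smul_of _ (α v)).symm

end PolynomialModules

section Tubes

variable {k : Type u} [Field k]

theorem R_affine_eq_ofModule (𝔪 : MaximalSpectrum k[X]) (t : ℕ) :
    haveI := finite_quotient_pow 𝔪.asIdeal (maximal_ne_bot 𝔪) t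
    R (.affine 𝔪) t = ofModule k (k[X] ⧸ 𝔪.asIdeal ^ t) :=
  rfl

/-- The maximal ideal of `k[X]` generated by `X`. -/
noncomputable def originIdeal (k : Type u) [Field k] : MaximalSpectrum k[X] :=
  ⟨Ideal.span {X}, PrincipalIdealRing.isMaximal_of_irreducible irreducible_X⟩

theorem eq_originIdeal {𝔪 : MaximalSpectrum k[X]} (h : X ∈ 𝔪.asIdeal) : 𝔪 = originIdeal k :=
  MaximalSpectrum.ext ((originIdeal k).isMaximal.eq_of_le 𝔪.isMaximal.ne_top
    ((Ideal.span_singleton_le_iff_mem _).2 h)).symm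

theorem R_infty_eq_swap (t : ℕ) :
    R (.infty : ClosedPoint k) t = (R (.affine (originIdeal k)) t).swap :=
  rfl

theorem indecomposable_R (x : ClosedPoint k) {t : ℕ} (ht : 1 ≤ t) : (R x t).Indecomposable := by
  have affine (𝔪 : MaximalSpectrum k[X]) : (R (.affine 𝔪) t).Indecomposable := by
    have := finite_quotient_pow 𝔪.asIdeal (maximal_ne_bot 𝔪) t
    have := 𝔪.isMaximal
    rw [R_affine_eq_ofModule, indecomposable_ofModule_iff, Ideal.Quotient.nontrivial_iff]
    refine ⟨fun h => this.ne_top (eq_top_iff.2 ?_),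
      fun e => end_quotient_pow_eq_zero_or_eq_one_of_isIdempotentElem⟩
    exact h ▸ Ideal.pow_le_self (Nat.one_le_iff_ne_zero.1 ht)
  cases x with
  | affine 𝔪 => exact affine 𝔪
  | infty => exact R_infty_eq_swap (k := k) t ▸ (affine (originIdeal k)).swap

theorem finrank_R₁_eq_finrank_R₂ (x : ClosedPoint k) (t : ℕ) :
    finrank k (R x t).V₁ = finrank k (R x t).V₂ := by
  cases x <;> rfl

theorem finrank_P₁ (n : ℕ) : finrank k (P k n).V₁ = n + 1 := Module.finrank_fin_fun k

theorem finrank_P₂ (n : ℕ) : finrank k (P k n).V₂ = n := Module.finrank_fin_fun k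

theorem finrank_I₁ (n : ℕ) : finrank k (I k n).V₁ = n := Module.finrank_fin_fun k

theorem finrank_I₂ (n : ℕ) : finrank k (I k n).V₂ = n + 1 := Module.finrank_fin_fun k

theorem isRegularIndecomposable_R (x : ClosedPoint k) {t : ℕ} (ht : 1 ≤ t) :
    (R x t).IsRegularIndecomposable := by
  have h_dim := finrank_R₁_eq_finrank_R₂ x t
  refine ⟨indecomposable_R x ht, fun n h => ?_, fun n h => ?_⟩
  · rw [h.finrank₁, h.finrank₂, finrank_P₁, finrank_P₂] at h_dim
    omega
  · rw [h.finrank₁, h.finrank₂, finrank_I₁, finrank_I₂] at h_dim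
    omega

theorem Indecomposable.exists_inTube_affine {M : KroneckerModule k} (h : M.Indecomposable)
    (ha : Function.Bijective M.a) : ∃ 𝔪, InTube (.affine 𝔪) M := by
  have hM := isIso_ofModule_of_bijective ha
  set T : Module.End k M.V₁ := M.b ∘ₗ (LinearEquiv.ofBijective M.a ha).symm.toLinearMap
  obtain ⟨_, hT⟩ := indecomposable_ofModule_iff.1 (h.of_isIso hM)
  obtain ⟨p, t, hp, ht, ⟨Φ⟩⟩ := exists_linearEquiv_quotient_span_pow
    (Module.AEval.isTorsion_of_finiteDimensional k M.V₁ T) hT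
  let 𝔪 : MaximalSpectrum k[X] := ⟨Ideal.span {p}, PrincipalIdealRing.isMaximal_of_irreducible hp⟩
  have := finite_quotient_pow 𝔪.asIdeal (maximal_ne_bot 𝔪) t
  exact ⟨𝔪, t, Nat.one_le_iff_ne_zero.2 ht, hM.trans (isIso_ofModule Φ)⟩

theorem injective_b_R_affine_of_X_notMem {𝔪 : MaximalSpectrum k[X]} (h : X ∉ 𝔪.asIdeal) (t : ℕ) :
    Function.Injective (R (.affine 𝔪) t).b :=
  have := 𝔪.isMaximal
  (Ideal.Quotient.isUnit_mk_pow_of_notMem 𝔪.asIdeal (n := t) h).mul_right_injective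

end Tubes

section Dichotomy

variable {k : Type u} [Field k] {M : KroneckerModule k}

theorem exists_hom_isProj_relChain {s : ℕ} (hs : relChain M.a M.b (s + 1) = relChain M.a M.b s) :
    ∃ e : Hom M M, LinearMap.IsProj ((relChain M.a M.b s).map M.b) e.φ₁ ∧
      LinearMap.IsProj (relChain M.a M.b s) e.φ₂ := by
  set K := relChain M.a M.b s
  obtain ⟨r, r_eq_zero, hr⟩ := exists_map_eq_zero_and_sub_mem (a := M.a) (L := K.map M.b) hs
  obtain ⟨ρ, hρ⟩ := exists_isProj (K.map M.b)
  have a_mem {v} (hv : v ∈ K) : M.a v ∈ K.map M.b := hs.ge hv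
  have b_mem {v} (hv : v ∈ K) : M.b v ∈ K.map M.b := Submodule.mem_map_of_mem hv
  let p₁ : M.V₁ →ₗ[k] M.V₁ := ρ ∘ₗ (LinearMap.id - M.a ∘ₗ r)
  let p₂ : M.V₂ →ₗ[k] M.V₂ := LinearMap.id - r ∘ₗ M.a
  have p₁_a (v) : p₁ (M.a v) = M.a (p₂ v) := by
    have := hρ.map_id _ (a_mem (hr v))
    simpa [p₁, p₂] using this
  -- `(p₁, p₂)` commutes with `a`; adding `(a φ r, φ r a)` makes it commute with `b` as well.
  obtain ⟨φ, φ_mem, hφ⟩ := exists_b_comp_sub_a_comp_comp_eq M.a M.b (r ∘ₗ M.b) s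
    (p₁ ∘ₗ M.b - M.b ∘ₗ p₂) fun v => sub_mem (hρ.map_mem _) (b_mem (hr v))
  have ra_eq_zero {v} (hv : v ∈ K) : r (M.a v) = 0 := r_eq_zero _ (a_mem hv)
  have rb_eq_zero {v} (hv : v ∈ K) : r (M.b v) = 0 := r_eq_zero _ (b_mem hv)
  have γ_eq_zero {v} (hv : v ∈ K) : p₁ (M.b v) = M.b (p₂ v) := by
    simp [p₁, p₂, ra_eq_zero hv, rb_eq_zero hv, hρ.map_id _ (b_mem hv)]
  have φ_eq (v) : M.b (φ (r (M.a v))) - M.a (φ (r (M.b v))) = p₁ (M.b v) - M.b (p₂ v) := by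
    have rb_eq := rb_eq_zero (hr v)
    have γ_eq := γ_eq_zero (hr v)
    rw [map_sub, map_sub, sub_eq_zero] at rb_eq
    rw [map_sub, map_sub, map_sub, map_sub, sub_eq_sub_iff_sub_eq_sub] at γ_eq
    rw [γ_eq, rb_eq]
    exact hφ (r (M.a v))
  let e₁ := p₁ + M.a ∘ₗ φ ∘ₗ r
  let e₂ := p₂ + φ ∘ₗ r ∘ₗ M.a
  refine ⟨⟨e₁, e₂, LinearMap.ext fun v => ?_, LinearMap.ext fun v => ?_⟩,
    ⟨fun v => add_mem (hρ.map_mem _) (a_mem (φ_mem _)), fun v hv => ?_⟩,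
    ⟨fun v => add_mem (hr v) (φ_mem _), fun v hv => ?_⟩⟩
  · simp [e₁, e₂, p₁_a]
  · have h := φ_eq v
    rw [sub_eq_sub_iff_add_eq_add] at h
    simpa only [e₁, e₂, LinearMap.comp_apply, LinearMap.add_apply, map_add, add_comm] using h.symm
  · simp [e₁, p₁, r_eq_zero v hv, hρ.map_id v hv]
  · simp [e₂, p₂, ra_eq_zero hv]

theorem Indecomposable.injective_a_or_surjective_b (h : M.Indecomposable) :
    Function.Injective M.a ∨ Function.Surjective M.b := by
  obtain ⟨s, hs⟩ := exists_relChain_succ_eq M.a M.b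
  obtain ⟨e, he₁, he₂⟩ := exists_hom_isProj_relChain hs
  refine (h.eq_bot_or_eq_top e he₁ he₂).imp (fun h_bot => ?_) (fun h_top => ?_)
  · rw [← LinearMap.ker_eq_bot, ← le_bot_iff, ← h_bot.2, ← hs]
    exact Submodule.comap_mono bot_le
  · rw [← LinearMap.range_eq_top, ← top_le_iff, ← h_top.1]
    exact LinearMap.map_le_range

theorem Indecomposable.exists_inTube (h : M.Indecomposable)
    (hd : finrank k M.V₁ = finrank k M.V₂) : ∃ x, InTube x M := by
  have inj_iff_surj {f : M.V₂ →ₗ[k] M.V₁} : Function.Injective f ↔ Function.Surjective f :=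
    LinearMap.injective_iff_surjective_of_finrank_eq_finrank hd.symm
  by_cases ha : Function.Injective M.a
  · exact (h.exists_inTube_affine ⟨ha, inj_iff_surj.1 ha⟩).imp' _ fun _ => id
  · have hb := h.injective_a_or_surjective_b.resolve_left ha
    obtain ⟨𝔪, t, ht, hM⟩ := h.swap.exists_inTube_affine ⟨inj_iff_surj.2 hb, hb⟩
    have h_mem : X ∈ 𝔪.asIdeal := by
      by_contra hX
      obtain ⟨e₁, e₂, -, he⟩ := hM
      refine ha fun v w hvw => e₂.injective (injective_b_R_affine_of_X_notMem hX t ?_)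
      exact (he v).symm.trans ((congrArg e₁ hvw).trans (he w))
    rw [eq_originIdeal h_mem] at hM
    exact ⟨.infty, t, ht, hM.swap⟩

end Dichotomy

section Reflection

variable {k : Type u} [Field k] {M N : KroneckerModule k}

theorem Hom.ext_of_injective_prod (hN : Function.Injective (N.a.prod N.b)) {f g : Hom M N}
    (h : f.φ₁ = g.φ₁) : f = g := by
  refine Hom.ext h (LinearMap.ext fun v => hN (Prod.ext ?_ ?_))
  · exact (f.a_apply v).symm.trans ((LinearMap.congr_fun h _).trans (g.a_apply v))
  · exact (f.b_apply v).symm.trans ((LinearMap.congr_fun h _).trans (g.b_apply v))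

theorem exists_hom_φ₁_eq (hN : Function.Injective (N.a.prod N.b)) (f : M.V₁ →ₗ[k] N.V₁)
    (hf : ∀ v, ∃ w, N.a w = f (M.a v) ∧ N.b w = f (M.b v)) : ∃ g : Hom M N, g.φ₁ = f := by
  obtain ⟨p, hp⟩ := (N.a.prod N.b).exists_leftInverse_of_injective (LinearMap.ker_eq_bot.2 hN)
  let φ : M.V₂ →ₗ[k] N.V₂ := p ∘ₗ (f ∘ₗ M.a).prod (f ∘ₗ M.b)
  have φ_spec (v) : N.a (φ v) = f (M.a v) ∧ N.b (φ v) = f (M.b v) := by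
    obtain ⟨w, hwa, hwb⟩ := hf v
    have φ_eq : φ v = w := by
      change p (f (M.a v), f (M.b v)) = w
      rw [← hwa, ← hwb]
      exact LinearMap.congr_fun hp w
    rw [φ_eq]
    exact ⟨hwa, hwb⟩
  exact ⟨⟨f, φ, LinearMap.ext fun v => (φ_spec v).1.symm,
    LinearMap.ext fun v => (φ_spec v).2.symm⟩, rfl⟩

theorem isIso_of_forall_exists_iff (hM : Function.Injective (M.a.prod M.b))
    (hN : Function.Injective (N.a.prod N.b)) (e : M.V₁ ≃ₗ[k] N.V₁)
    (he : ∀ x y, (∃ v, M.a v = x ∧ M.b v = y) ↔ ∃ w, N.a w = e x ∧ N.b w = e y) :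
    M.IsIso N := by
  obtain ⟨f, hf⟩ := exists_hom_φ₁_eq hN e.toLinearMap fun v => (he _ _).1 ⟨v, rfl, rfl⟩
  obtain ⟨g, hg⟩ := exists_hom_φ₁_eq hM e.symm.toLinearMap fun w => (he _ _).2 ⟨w, by simp⟩
  have fg_eq_id : f.comp g = Hom.id N := Hom.ext_of_injective_prod hN <| by
    change f.φ₁ ∘ₗ g.φ₁ = LinearMap.id
    rw [hf, hg, e.comp_symm]
  have gf_eq_id : g.comp f = Hom.id M := Hom.ext_of_injective_prod hM <| by
    change g.φ₁ ∘ₗ f.φ₁ = LinearMap.id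
    rw [hf, hg, e.symm_comp]
  refine ⟨e, LinearEquiv.ofLinearMap f.φ₂ g.φ₂ (congrArg Hom.φ₂ fg_eq_id)
    (congrArg Hom.φ₂ gf_eq_id), fun v => ?_, fun v => ?_⟩
  · exact (LinearMap.congr_fun hf _).symm.trans (f.a_apply v)
  · exact (LinearMap.congr_fun hf _).symm.trans (f.b_apply v)

/-- The Bernstein–Gelfand–Ponomarev reflection of `M` at the source `2` of the Kronecker quiver:
the two maps to the cokernel of `(a, b) : V₂ → V₁ × V₁`. The sign makes `(a v, b v)` a solution
`(x, y)` of `a y = b x` in the reflection. -/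
abbrev reflection (M : KroneckerModule k) : KroneckerModule k where
  V₁ := (M.V₁ × M.V₁) ⧸ LinearMap.range (M.a.prod M.b)
  V₂ := M.V₁
  a := Submodule.mkQ _ ∘ₗ LinearMap.inr k _ _
  b := -(Submodule.mkQ _ ∘ₗ LinearMap.inl k _ _)

theorem reflection_a_sub_b (x y : M.V₁) : M.reflection.a y - M.reflection.b x =
    (LinearMap.range (M.a.prod M.b)).mkQ (x, y) := by
  have h : ((x, y) : M.V₁ × M.V₁) = (0, y) + (x, 0) := by simp
  rw [h, map_add, LinearMap.neg_apply, sub_neg_eq_add]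
  rfl

theorem reflection_a_eq_b_iff {x y : M.V₁} :
    M.reflection.a y = M.reflection.b x ↔ ∃ v, M.a v = x ∧ M.b v = y := by
  rw [← sub_eq_zero, reflection_a_sub_b]
  refine (Submodule.Quotient.mk_eq_zero _).trans ?_
  simp [Prod.ext_iff]

theorem Hom.ext_of_reflection {f g : Hom M.reflection N} (h : f.φ₂ = g.φ₂) : f = g := by
  refine Hom.ext (LinearMap.ext fun w => ?_) h
  obtain ⟨⟨x, y⟩, rfl⟩ := Submodule.mkQ_surjective _ w
  rw [← reflection_a_sub_b, map_sub, map_sub, f.a_apply, g.a_apply, f.b_apply, g.b_apply, h]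

theorem Indecomposable.reflection (h : M.Indecomposable)
    (hM : Function.Injective (M.a.prod M.b)) : M.reflection.Indecomposable := by
  rw [indecomposable_iff] at h ⊢
  refine ⟨fun ⟨_, (h₁ : Subsingleton M.V₁)⟩ => h.1 ⟨h₁, hM.subsingleton⟩, fun e he => ?_⟩
  obtain ⟨e', he'⟩ := exists_hom_φ₁_eq (f := e.φ₂) hM fun v => by
    have hv := reflection_a_eq_b_iff.2 ⟨v, rfl, rfl⟩
    rw [← reflection_a_eq_b_iff, ← e.a_apply, ← e.b_apply, hv]
  have e'_idem : e'.comp e' = e' := Hom.ext_of_injective_prod hM <| by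
    change e'.φ₁ ∘ₗ e'.φ₁ = e'.φ₁
    rw [he']
    exact congrArg Hom.φ₂ he
  refine (h.2 e' e'_idem).imp (fun h0 => ?_) (fun h1 => ?_)
  · exact Hom.ext_of_reflection (he'.symm.trans (congrArg Hom.φ₁ h0))
  · exact Hom.ext_of_reflection (he'.symm.trans (congrArg Hom.φ₁ h1))

end Reflection

section Preinjective

variable {k : Type u} [Field k] {M : KroneckerModule k}

theorem I_a_apply {n : ℕ} (v : Fin (n + 1) → k) : (I k n).a v = fun i => v i.castSucc := by
  refine funext fun (i : Fin n) => ?_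
  change Matrix.toLin' (upperBlock k n).transpose v i = _
  simp [upperBlock, Matrix.mulVec, dotProduct]

theorem I_b_apply {n : ℕ} (v : Fin (n + 1) → k) : (I k n).b v = fun i => v i.succ := by
  refine funext fun (i : Fin n) => ?_
  change Matrix.toLin' (lowerBlock k n).transpose v i = _
  simp [lowerBlock, Matrix.mulVec, dotProduct]

theorem injective_I_a_prod_b (n : ℕ) :
    Function.Injective ((I k (n + 1)).a.prod (I k (n + 1)).b) := by
  intro (v : Fin (n + 2) → k) (w : Fin (n + 2) → k) hvw
  have ha := (I_a_apply v).symm.trans ((congrArg Prod.fst hvw).trans (I_a_apply w))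
  have hb := (I_b_apply v).symm.trans ((congrArg Prod.snd hvw).trans (I_b_apply w))
  exact funext fun i => Fin.cases (congrFun ha 0) (congrFun hb) i

theorem exists_I_succ_a_eq_and_b_eq_iff {n : ℕ} {x y : Fin (n + 1) → k} :
    (∃ v, (I k (n + 1)).a v = x ∧ (I k (n + 1)).b v = y) ↔ (I k n).a y = (I k n).b x := by
  rw [I_a_apply, I_b_apply]
  constructor
  · rintro ⟨v, ha, hb⟩
    rw [← (I_a_apply v).symm.trans ha, ← (I_b_apply v).symm.trans hb]
    rfl
  · intro h
    refine ⟨(Fin.cons (x 0) y : Fin (n + 2) → k), (I_a_apply _).trans (funext fun i => ?_),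
      I_b_apply _⟩
    exact Fin.cases rfl (congrFun h) i

theorem isIso_I_succ_of_reflection (hM : Function.Injective (M.a.prod M.b)) {n : ℕ}
    (h : M.reflection.IsIso (I k n)) : M.IsIso (I k (n + 1)) := by
  obtain ⟨f₁, f₂, ha, hb⟩ := h
  refine isIso_of_forall_exists_iff hM (injective_I_a_prod_b n) f₂ fun x y => ?_
  refine (reflection_a_eq_b_iff.symm.trans ?_).trans exists_I_succ_a_eq_and_b_eq_iff.symm
  rw [← f₁.injective.eq_iff, ha, hb]
  rfl

theorem Indecomposable.isIso_I_zero (h : M.Indecomposable)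
    (hM : ¬ Function.Injective (M.a.prod M.b)) : M.IsIso (I k 0) := by
  obtain ⟨v, ha, hb, hv0⟩ : ∃ v, M.a v = 0 ∧ M.b v = 0 ∧ v ≠ 0 := by
    simpa [injective_iff_map_eq_zero] using hM
  have map_eq_zero : ∀ w ∈ k ∙ v, M.a w = 0 ∧ M.b w = 0 := fun w hw => by
    obtain ⟨c, rfl⟩ := Submodule.mem_span_singleton.1 hw
    simp only [map_smul, ha, hb, smul_zero, and_self]
  obtain ⟨ρ, hρ⟩ := exists_isProj (k ∙ v)
  let e : Hom M M := ⟨0, ρ, LinearMap.ext fun w => (map_eq_zero _ (hρ.map_mem w)).1.symm,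
    LinearMap.ext fun w => (map_eq_zero _ (hρ.map_mem w)).2.symm⟩
  have h_proj : LinearMap.IsProj (⊥ : Submodule k M.V₁) e.φ₁ :=
    ⟨fun _ => zero_mem _, fun w hw => hw.symm⟩
  rcases h.eq_bot_or_eq_top e h_proj hρ with ⟨-, h_bot⟩ | ⟨h_top, h_top'⟩
  · exact absurd (Submodule.span_singleton_eq_bot.1 h_bot) hv0
  · have h₁ : finrank k M.V₁ = finrank k (I k 0).V₁ := by
      rw [← finrank_top, ← h_top, finrank_bot, finrank_I₁]
    have h₂ : finrank k M.V₂ = finrank k (I k 0).V₂ := by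
      rw [← finrank_top, ← h_top', finrank_span_singleton hv0, finrank_I₂]
    exact ⟨LinearEquiv.ofFinrankEq _ _ h₁, LinearEquiv.ofFinrankEq _ _ h₂,
      fun _ => funext fun i => i.elim0, fun _ => funext fun i => i.elim0⟩

theorem finrank_reflection₁ (hM : Function.Injective (M.a.prod M.b)) :
    finrank k M.reflection.V₁ + finrank k M.V₂ = finrank k M.V₁ + finrank k M.V₁ := by
  rw [← LinearMap.finrank_range_of_inj hM]
  exact (LinearMap.range (M.a.prod M.b)).finrank_quotient_add_finrank.trans finrank_prod

theorem Indecomposable.exists_isIso_I (h : M.Indecomposable)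
    (hd : finrank k M.V₁ < finrank k M.V₂) : ∃ n, M.IsIso (I k n) := by
  induction hn : finrank k M.V₁ using Nat.strong_induction_on generalizing M with
  | _ n ih =>
    by_cases hM : Function.Injective (M.a.prod M.b)
    · have finrank_lt : finrank k M.reflection.V₁ < finrank k M.V₁ := by
        have := finrank_reflection₁ hM
        omega
      obtain ⟨j, hj⟩ := ih _ (hn ▸ finrank_lt) (h.reflection hM) finrank_lt rfl
      exact ⟨j + 1, isIso_I_succ_of_reflection hM hj⟩
    · exact ⟨0, h.isIso_I_zero hM⟩

theorem finrank_directSum₁ {r : ℕ} (Y : Fin r → KroneckerModule k) :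
    finrank k (directSum Y).V₁ = ∑ i, finrank k (Y i).V₁ :=
  finrank_pi_fintype k

theorem finrank_directSum₂ {r : ℕ} (Y : Fin r → KroneckerModule k) :
    finrank k (directSum Y).V₂ = ∑ i, finrank k (Y i).V₂ :=
  finrank_pi_fintype k

theorem IsIso.exists_inTube_of_finrank_eq {r : ℕ} {Y : Fin r → KroneckerModule k}
    (hM : M.IsIso (KroneckerModule.directSum Y)) (hY : ∀ i, (Y i).IsRegularIndecomposable)
    (hd : finrank k M.V₁ = finrank k M.V₂) (i : Fin r) : ∃ x, InTube x (Y i) := by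
  rw [hM.finrank₁, hM.finrank₂, finrank_directSum₁, finrank_directSum₂] at hd
  have finrank_le (i) : finrank k (Y i).V₂ ≤ finrank k (Y i).V₁ := by
    by_contra! hlt
    obtain ⟨n, hn⟩ := (hY i).1.exists_isIso_I hlt
    exact (hY i).2.2 n hn
  exact (hY i).1.exists_inTube ((Finset.sum_eq_sum_iff_of_le fun i _ => finrank_le i).1
    hd.symm i (Finset.mem_univ i)).symm

end Preinjective

section Preprojectives

open scoped Matrix

variable {k : Type u} [Field k] {m n : ℕ}

theorem upperBlock_mulVec (v : Fin n → k) :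
    upperBlock k n *ᵥ v = Fin.snoc (α := fun _ => k) v 0 := by
  ext i
  refine Fin.lastCases ?_ (fun i => ?_) i
  · simp [upperBlock, Matrix.mulVec, dotProduct, (Fin.castSucc_lt_last _).ne']
  · simp [upperBlock, Matrix.mulVec, dotProduct]

theorem lowerBlock_mulVec (v : Fin n → k) : lowerBlock k n *ᵥ v = Fin.cons 0 v := by
  ext i
  refine Fin.cases ?_ (fun i => ?_) i
  · simp [lowerBlock, Matrix.mulVec, dotProduct, (Fin.succ_ne_zero _).symm]
  · simp [lowerBlock, Matrix.mulVec, dotProduct]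

theorem toPoly_upperBlock_mulVec (v : Fin n → k) :
    toPoly (n + 1) (upperBlock k n *ᵥ v) = toPoly n v := by
  simp [toPoly_apply, upperBlock_mulVec, Fin.sum_univ_castSucc]

theorem toPoly_lowerBlock_mulVec (v : Fin n → k) :
    toPoly (n + 1) (lowerBlock k n *ᵥ v) = X * toPoly n v := by
  simp [toPoly_apply, lowerBlock_mulVec, Fin.sum_univ_succ, Finset.mul_sum, X_mul_monomial]

/-- The isomorphism of `Pₙ` with its `swap` which reverses the coefficients. -/
def reverse (k : Type u) [Field k] (n : ℕ) : Hom (P k n) (P k n).swap where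
  φ₁ := LinearMap.funLeft k k (Fin.rev : Fin (n + 1) → Fin (n + 1))
  φ₂ := LinearMap.funLeft k k (Fin.rev : Fin n → Fin n)
  comm_a := LinearMap.ext fun (v : Fin n → k) => funext fun (i : Fin (n + 1)) => by
    change (upperBlock k n *ᵥ v) i.rev = (lowerBlock k n *ᵥ (v ∘ Fin.rev)) i
    rw [upperBlock_mulVec, lowerBlock_mulVec, Fin.snoc_rev]
  comm_b := LinearMap.ext fun (v : Fin n → k) => funext fun (i : Fin (n + 1)) => by
    change (lowerBlock k n *ᵥ v) i.rev = (upperBlock k n *ᵥ (v ∘ Fin.rev)) i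
    rw [upperBlock_mulVec, lowerBlock_mulVec, Fin.cons_rev]

theorem reverse_surjective : Function.Surjective (reverse k n).φ₁ :=
  LinearMap.funLeft_surjective_of_injective k k (Fin.rev : Fin (n + 1) → _) Fin.rev_injective

theorem upperBlock_mulVec_single (i : Fin n) :
    upperBlock k n *ᵥ Pi.single i 1 = Pi.single i.castSucc 1 :=
  toPoly_injective _ <| by
    rw [toPoly_upperBlock_mulVec, toPoly_single, toPoly_single, Fin.val_castSucc]

theorem lowerBlock_mulVec_single (i : Fin n) :
    lowerBlock k n *ᵥ Pi.single i 1 = Pi.single i.succ 1 :=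
  toPoly_injective _ <| by
    rw [toPoly_lowerBlock_mulVec, toPoly_single, toPoly_single, Fin.val_succ, pow_succ']

theorem map_eq_toPoly_smul {W : Type*} [AddCommGroup W] [Module k W] [Module k[X] W]
    [IsScalarTower k k[X] W] (φ₁ : (Fin (n + 1) → k) →ₗ[k] W) (φ₂ : (Fin n → k) →ₗ[k] W)
    (ha : ∀ v, φ₁ (upperBlock k n *ᵥ v) = φ₂ v)
    (hb : ∀ v, φ₁ (lowerBlock k n *ᵥ v) = (X : k[X]) • φ₂ v) (v : Fin (n + 1) → k) :
    φ₁ v = toPoly (n + 1) v • φ₁ (Pi.single 0 1) := by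
  have map_single (i : Fin (n + 1)) :
      φ₁ (Pi.single i 1) = (X : k[X]) ^ (i : ℕ) • φ₁ (Pi.single 0 1) := by
    induction i using Fin.induction with
    | zero => rw [Fin.val_zero, pow_zero, one_smul]
    | succ i ih =>
      rw [← lowerBlock_mulVec_single, hb, ← ha, upperBlock_mulVec_single, ih, smul_smul,
        Fin.val_castSucc, Fin.val_succ, pow_succ']
  suffices φ₁ = (LinearMap.toSpanSingleton k[X] W (φ₁ (Pi.single 0 1))).restrictScalars k ∘ₗ
      toPoly (n + 1) from LinearMap.congr_fun this v
  refine (Pi.basisFun k (Fin (n + 1))).ext fun i => ?_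
  rw [Pi.basisFun_apply, map_single, ← toPoly_single]
  rfl

theorem Hom.exists_toPoly_eq_mul (f : Hom (P k n) (P k m)) :
    ∃ F : k[X], (∀ v, toPoly (m + 1) (f.φ₁ v) = F * toPoly (n + 1) v) ∧
      ∀ v, toPoly m (f.φ₂ v) = F * toPoly n v := by
  let f₁ : (Fin (n + 1) → k) →ₗ[k] (Fin (m + 1) → k) := f.φ₁
  let f₂ : (Fin n → k) →ₗ[k] (Fin m → k) := f.φ₂
  have map_upperBlock (v) : toPoly (m + 1) (f₁ (upperBlock k n *ᵥ v)) = toPoly m (f₂ v) :=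
    (congrArg (toPoly (m + 1)) (f.a_apply v)).trans (toPoly_upperBlock_mulVec (f₂ v))
  have map_lowerBlock (v) : toPoly (m + 1) (f₁ (lowerBlock k n *ᵥ v)) = X * toPoly m (f₂ v) :=
    (congrArg (toPoly (m + 1)) (f.b_apply v)).trans (toPoly_lowerBlock_mulVec (f₂ v))
  have h₁ (v) : toPoly (m + 1) (f₁ v) = toPoly (m + 1) (f₁ (Pi.single 0 1)) * toPoly (n + 1) v :=
    (map_eq_toPoly_smul (toPoly (m + 1) ∘ₗ f₁) (toPoly m ∘ₗ f₂) map_upperBlock map_lowerBlock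
      v).trans (mul_comm _ _)
  refine ⟨_, h₁, fun (v : Fin n → k) => (map_upperBlock v).symm.trans ?_⟩
  rw [h₁, toPoly_upperBlock_mulVec]

theorem exists_hom_toPoly_eq_mul {F : k[X]} (h : n + F.natDegree ≤ m) :
    ∃ f : Hom (P k n) (P k m), (∀ v, toPoly (m + 1) (f.φ₁ v) = F * toPoly (n + 1) v) ∧
      ∀ v, toPoly m (f.φ₂ v) = F * toPoly n v := by
  obtain ⟨f₁, hf₁⟩ := exists_linearMap_toPoly_eq_mul (n := n + 1) (m := m + 1) (F := F) (by omega)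
  obtain ⟨f₂, hf₂⟩ := exists_linearMap_toPoly_eq_mul h
  refine ⟨⟨f₁, f₂, LinearMap.ext fun (v : Fin n → k) => toPoly_injective (m + 1) ?_,
    LinearMap.ext fun (v : Fin n → k) => toPoly_injective (m + 1) ?_⟩, hf₁, hf₂⟩
  · change toPoly (m + 1) (f₁ (upperBlock k n *ᵥ v)) = toPoly (m + 1) (upperBlock k m *ᵥ f₂ v)
    rw [hf₁, toPoly_upperBlock_mulVec, toPoly_upperBlock_mulVec, hf₂]
  · change toPoly (m + 1) (f₁ (lowerBlock k n *ᵥ v)) = toPoly (m + 1) (lowerBlock k m *ᵥ f₂ v)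
    rw [hf₁, toPoly_lowerBlock_mulVec, toPoly_lowerBlock_mulVec, hf₂, mul_left_comm]

end Preprojectives

section DistinctTubes

variable {k : Type u} [Field k]

theorem Hom.apply_eq_toPoly_smul {W : Type u} [AddCommGroup W] [Module k W] [Module.Finite k W]
    [Module k[X] W] [IsScalarTower k k[X] W] {n : ℕ} (f : Hom (P k n) (ofModule k W)) :
    ∃ c : W, ∀ v, f.φ₁ v = toPoly (n + 1) v • c :=
  ⟨_, map_eq_toPoly_smul f.φ₁ f.φ₂ f.a_apply f.b_apply⟩

theorem not_surjective_prod_R {m t t' : ℕ} (x : ClosedPoint k) (ht : 1 ≤ t) (ht' : 1 ≤ t')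
    (f : Hom (P k m) (R x t)) (f' : Hom (P k m) (R x t')) :
    ¬ Function.Surjective (f.φ₁.prod f'.φ₁) := by
  have affine (𝔪 : MaximalSpectrum k[X]) (f : Hom (P k m) (R (.affine 𝔪) t))
      (f' : Hom (P k m) (R (.affine 𝔪) t')) : ¬ Function.Surjective (f.φ₁.prod f'.φ₁) := by
    intro h
    have := 𝔪.isMaximal
    have := finite_quotient_pow 𝔪.asIdeal (maximal_ne_bot 𝔪)
    obtain ⟨c, hc⟩ := Hom.apply_eq_toPoly_smul (W := k[X] ⧸ 𝔪.asIdeal ^ t) f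
    obtain ⟨c', hc'⟩ := Hom.apply_eq_toPoly_smul (W := k[X] ⧸ 𝔪.asIdeal ^ t') f'
    refine not_surjective_smul_quotient_pow_prod (Nat.one_le_iff_ne_zero.1 ht)
      (Nat.one_le_iff_ne_zero.1 ht') c c' fun y => ?_
    obtain ⟨v, rfl⟩ := h y
    exact ⟨toPoly (m + 1) v, Prod.ext (hc v).symm (hc' v).symm⟩
  cases x with
  | affine 𝔪 => exact affine 𝔪 f f'
  | infty =>
    exact fun h => affine (originIdeal k) (f.swap.comp (reverse k m))
      (f'.swap.comp (reverse k m)) (h.comp reverse_surjective)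

theorem summandsInDistinctTubes_of_surjective {m : ℕ} {M : KroneckerModule k}
    (g : Hom (P k m) M) (hg : Function.Surjective g.φ₁) : M.SummandsInDistinctTubes := by
  rintro r Y - hiso i j hij x _ ⟨t, ht, hi⟩ ⟨t', ht', hj⟩ rfl
  obtain ⟨e₁, e₂, ha, hb⟩ := hiso
  obtain ⟨p₁, p₂, hpa, hpb⟩ := hi
  obtain ⟨q₁, q₂, hqa, hqb⟩ := hj
  let e : Hom M (directSum Y) := ⟨e₁, e₂, LinearMap.ext ha, LinearMap.ext hb⟩
  let p : Hom (Y i) (R x t) := ⟨p₁, p₂, LinearMap.ext hpa, LinearMap.ext hpb⟩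
  let q : Hom (Y j) (R x t') := ⟨q₁, q₂, LinearMap.ext hqa, LinearMap.ext hqb⟩
  refine not_surjective_prod_R x ht ht' (p.comp ((Hom.proj Y i).comp (e.comp g)))
    (q.comp ((Hom.proj Y j).comp (e.comp g))) fun ⟨y, y'⟩ => ?_
  let w : ∀ l, (Y l).V₁ := Function.update (Function.update 0 i (p₁.symm y)) j (q₁.symm y')
  have w_i : p₁ (w i) = y := by simp [w, hij]
  have w_j : q₁ (w j) = y' := by simp [w]
  obtain ⟨v, hv⟩ := e₁.surjective.comp hg w
  exact ⟨v, Prod.ext ((congrArg p₁ (congrFun hv i)).trans w_i)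
    ((congrArg q₁ (congrFun hv j)).trans w_j)⟩

end DistinctTubes

section ClosedPoints

variable {k : Type u} [Field k]

/-- An equation of a closed point of the affine line, and `1` for the point at infinity, which has
no zero on the affine line. -/
noncomputable def ClosedPoint.poly : ClosedPoint k → k[X]
  | .affine 𝔪 => Submodule.IsPrincipal.generator 𝔪.asIdeal
  | .infty => 1

/-- The indicator function of the point at infinity. -/
def ClosedPoint.atInfty : ClosedPoint k → ℕ
  | .affine _ => 0
  | .infty => 1

theorem span_poly_affine (𝔪 : MaximalSpectrum k[X]) :
    Ideal.span {(ClosedPoint.affine 𝔪).poly} = 𝔪.asIdeal :=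
  Ideal.span_singleton_generator _

theorem poly_ne_zero (x : ClosedPoint k) : x.poly ≠ 0 := by
  cases x with
  | affine 𝔪 =>
    exact mt (Submodule.IsPrincipal.eq_bot_iff_generator_eq_zero _).2 (maximal_ne_bot 𝔪)
  | infty => exact one_ne_zero

theorem prod_poly_pow_ne_zero {r : ℕ} (x : Fin r → ClosedPoint k) (t : Fin r → ℕ) :
    ∏ i, (x i).poly ^ t i ≠ 0 :=
  Finset.prod_ne_zero_iff.2 fun i _ => pow_ne_zero (t i) (poly_ne_zero (x i))

theorem isCoprime_poly {x y : ClosedPoint k} (h : x ≠ y) : IsCoprime x.poly y.poly := by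
  cases x with
  | infty => exact isCoprime_one_left
  | affine 𝔪 =>
    cases y with
    | infty => exact isCoprime_one_right
    | affine 𝔫 =>
      rw [← Ideal.isCoprime_span_singleton_iff, span_poly_affine, span_poly_affine]
      exact Ideal.isCoprime_iff_sup_eq.2 (𝔪.isMaximal.coprime_of_ne 𝔫.isMaximal
        fun e => h (congrArg ClosedPoint.affine (MaximalSpectrum.ext e)))

theorem finrank_R (x : ClosedPoint k) (t : ℕ) :
    finrank k (R x t).V₁ = (x.poly ^ t).natDegree + x.atInfty * t := by
  cases x with
  | affine 𝔪 =>
    change finrank k (k[X] ⧸ 𝔪.asIdeal ^ t) = _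
    rw [← span_poly_affine, Ideal.span_singleton_pow, finrank_quotient_span_eq_natDegree,
      ClosedPoint.atInfty, zero_mul, add_zero]
  | infty =>
    change finrank k (k[X] ⧸ (Ideal.span {X} : Ideal k[X]) ^ t) = _
    rw [Ideal.span_singleton_pow, finrank_quotient_span_eq_natDegree]
    simp [ClosedPoint.poly, ClosedPoint.atInfty]

/-- The binary form of degree `n - 1` whose dehomogenization is `q` vanishes to order at least `t`
at `x`. At infinity this bounds the degree of `q`. -/
def VanishesToOrder (x : ClosedPoint k) (t n : ℕ) (q : k[X]) : Prop :=
  x.poly ^ t ∣ q ∧ q ∈ degreeLT k (n - x.atInfty * t)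

theorem sum_atInfty_mul_eq_zero {r : ℕ} {x : Fin r → ClosedPoint k} (hx : ∀ i, x i ≠ .infty)
    (t : Fin r → ℕ) : ∑ i, (x i).atInfty * t i = 0 :=
  Finset.sum_eq_zero fun i _ => by
    cases hxi : x i with
    | affine 𝔪 => exact zero_mul _
    | infty => exact absurd hxi (hx i)

theorem mem_degreeLT_sub_sum_atInfty_mul_iff {r : ℕ} {x : Fin r → ClosedPoint k}
    (hx : Function.Injective x) (t : Fin r → ℕ) {n : ℕ} {q : k[X]} (hq : q ∈ degreeLT k n) :
    q ∈ degreeLT k (n - ∑ i, (x i).atInfty * t i) ↔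
      ∀ i, q ∈ degreeLT k (n - (x i).atInfty * t i) := by
  refine ⟨fun h i => degreeLT_mono (Nat.sub_le_sub_left (Finset.single_le_sum
    (f := fun i => (x i).atInfty * t i) (fun _ _ => Nat.zero_le _) (Finset.mem_univ i)) n) h,
    fun h => ?_⟩
  by_cases h_infty : ∃ i, x i = .infty
  · obtain ⟨i, hi⟩ := h_infty
    rw [Finset.sum_eq_single_of_mem i (Finset.mem_univ i)]
    · exact h i
    · intro j _ hji
      cases hj : x j with
      | affine 𝔪 => exact zero_mul _
      | infty => exact absurd (hx (hj.trans hi.symm)) hji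
  · rwa [sum_atInfty_mul_eq_zero (not_exists.1 h_infty)]

theorem dvd_iff_forall_poly_pow_dvd {r : ℕ} {x : Fin r → ClosedPoint k}
    (hx : Function.Injective x) (t : Fin r → ℕ) {F : k[X]}
    (hF : Associated F (∏ i, (x i).poly ^ t i)) (q : k[X]) :
    F ∣ q ↔ ∀ i, (x i).poly ^ t i ∣ q := by
  rw [hF.dvd_iff_dvd_left]
  exact ⟨fun h i =>
    (Finset.dvd_prod_of_mem (fun i => (x i).poly ^ t i) (Finset.mem_univ i)).trans h,
    Fintype.prod_dvd_of_coprime fun i j hij => (isCoprime_poly (hx.ne hij)).pow⟩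

theorem forall_vanishesToOrder_iff {r : ℕ} {x : Fin r → ClosedPoint k}
    (hx : Function.Injective x) (t : Fin r → ℕ) {F : k[X]}
    (hF : Associated F (∏ i, (x i).poly ^ t i)) {n m : ℕ}
    (hm : n + F.natDegree + ∑ i, (x i).atInfty * t i = m) {q : k[X]} (hq : q ∈ degreeLT k m) :
    (∀ i, VanishesToOrder (x i) (t i) m q) ↔ ∃ w, F * toPoly n w = q := by
  have hF0 : F ≠ 0 := hF.ne_zero_iff.2 (prod_poly_pow_ne_zero x t)
  have h_sub : m - ∑ i, (x i).atInfty * t i = n + F.natDegree := by omega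
  simp only [VanishesToOrder, forall_and]
  rw [← mem_degreeLT_sub_sum_atInfty_mul_iff hx t hq, h_sub,
    ← dvd_iff_forall_poly_pow_dvd hx t hF]
  constructor
  · rintro ⟨⟨q, rfl⟩, h⟩
    obtain ⟨w, rfl⟩ := exists_toPoly_eq ((mul_mem_degreeLT_iff hF0).1 h)
    exact ⟨w, rfl⟩
  · rintro ⟨w, rfl⟩
    exact ⟨dvd_mul_right _ _, (mul_mem_degreeLT_iff hF0).2 (toPoly_mem_degreeLT w)⟩

theorem sum_finrank_R {r : ℕ} (x : Fin r → ClosedPoint k) (t : Fin r → ℕ) {F : k[X]}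
    (hF : Associated F (∏ i, (x i).poly ^ t i)) :
    ∑ i, finrank k (R (x i) (t i)).V₁ = F.natDegree + ∑ i, (x i).atInfty * t i := by
  rw [natDegree_eq_of_degree_eq (degree_eq_degree_of_associated hF),
    natDegree_prod _ _ fun i _ => pow_ne_zero _ (poly_ne_zero _), ← Finset.sum_add_distrib]
  exact Finset.sum_congr rfl fun i _ => finrank_R (x i) (t i)

end ClosedPoints

section Factorization

variable {k : Type u} [Field k]

/-- The point of the affine line defined by an irreducible polynomial. -/
noncomputable def affinePoint {p : k[X]} (hp : Irreducible p) : ClosedPoint k :=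
  .affine ⟨Ideal.span {p}, PrincipalIdealRing.isMaximal_of_irreducible hp⟩

theorem associated_poly_affinePoint {p : k[X]} (hp : Irreducible p) :
    Associated p (affinePoint hp).poly :=
  (Ideal.span_singleton_eq_span_singleton.1 (span_poly_affine _)).symm

theorem associated_of_affinePoint_eq {p q : k[X]} {hp : Irreducible p} {hq : Irreducible q}
    (h : affinePoint hp = affinePoint hq) : Associated p q :=
  (associated_poly_affinePoint hp).trans (h ▸ (associated_poly_affinePoint hq).symm)

theorem exists_associated_prod_affine {F : k[X]} (hF : F ≠ 0) :
    ∃ (r : ℕ) (x : Fin r → ClosedPoint k) (t : Fin r → ℕ), Function.Injective x ∧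
      (∀ i, x i ≠ .infty) ∧ (∀ i, 1 ≤ t i) ∧ Associated F (∏ i, (x i).poly ^ t i) := by
  classical
  let factors := UniqueFactorizationMonoid.normalizedFactors F
  let p := factors.toFinset.equivFin.symm
  have mem_factors (i) : (p i : k[X]) ∈ factors := Multiset.mem_toFinset.1 (p i).2
  have irreducible_p (i) : Irreducible (p i : k[X]) :=
    UniqueFactorizationMonoid.irreducible_of_normalized_factor _ (mem_factors i)
  have normalize_p (i) : normalize (p i : k[X]) = p i :=
    UniqueFactorizationMonoid.normalize_normalized_factor _ (mem_factors i)
  refine ⟨_, fun i => affinePoint (irreducible_p i), fun i => factors.count (p i : k[X]),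
    fun i j h => p.injective (Subtype.ext ?_), fun i => nofun,
    fun i => Multiset.one_le_count_iff_mem.2 (mem_factors i), ?_⟩
  · rw [← normalize_p i, ← normalize_p j, normalize_eq_normalize_iff_associated]
    exact associated_of_affinePoint_eq h
  · refine (UniqueFactorizationMonoid.prod_normalizedFactors hF).symm.trans ?_
    rw [Finset.prod_multiset_count, ← Finset.prod_coe_sort, ← p.prod_comp]
    exact Associated.prod _ _ _ fun i _ => (associated_poly_affinePoint (irreducible_p i)).pow_pow

theorem exists_associated_prod {F : k[X]} (hF : F ≠ 0) {d : ℕ} (hd : F.natDegree ≤ d) :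
    ∃ (r : ℕ) (x : Fin r → ClosedPoint k) (t : Fin r → ℕ), Function.Injective x ∧
      (∀ i, 1 ≤ t i) ∧ Associated F (∏ i, (x i).poly ^ t i) ∧
      F.natDegree + ∑ i, (x i).atInfty * t i = d := by
  obtain ⟨r, x, t, hx, h_affine, ht, h_prod⟩ := exists_associated_prod_affine hF
  have h_sum := sum_atInfty_mul_eq_zero h_affine t
  rcases hd.eq_or_lt with hd | hd
  · exact ⟨r, x, t, hx, ht, h_prod, by rw [h_sum, add_zero, hd]⟩
  · refine ⟨r + 1, Fin.cons .infty x, Fin.cons (d - F.natDegree) t,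
      Fin.cons_injective_iff.2 ⟨fun ⟨i, hi⟩ => h_affine i hi, hx⟩,
      Fin.cases (Nat.sub_pos_of_lt hd) ht, ?_, ?_⟩
    · simpa [Fin.prod_univ_succ, ClosedPoint.poly] using h_prod
    · simp only [Fin.sum_univ_succ, Fin.cons_zero, Fin.cons_succ, h_sum]
      simp only [ClosedPoint.atInfty]
      omega

end Factorization

section ShortExact

variable {k : Type u} [Field k] {L M N N' : KroneckerModule k} {f : Hom L M} {g : Hom M N}

theorem IsShortExact.isIso {g' : Hom M N'} (h : IsShortExact f g) (h' : IsShortExact f g') :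
    N.IsIso N' := by
  obtain ⟨⟨-, exact₁, surj₁⟩, -, exact₂, surj₂⟩ := h
  obtain ⟨⟨-, exact₁', surj₁'⟩, -, exact₂', surj₂'⟩ := h'
  obtain ⟨e₁, he₁⟩ := exists_linearEquiv_of_exact exact₁ surj₁ exact₁' surj₁'
  obtain ⟨e₂, he₂⟩ := exists_linearEquiv_of_exact exact₂ surj₂ exact₂' surj₂'
  refine ⟨e₁, e₂, surj₂.forall.2 fun v => ?_, surj₂.forall.2 fun v => ?_⟩
  · rw [← g.a_apply, he₁, he₂, g'.a_apply]
  · rw [← g.b_apply, he₁, he₂, g'.b_apply]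

theorem IsShortExact.exists_of_isIso (h : IsShortExact f g) (hN : N.IsIso N') :
    ∃ g' : Hom M N', IsShortExact f g' := by
  obtain ⟨⟨inj₁, exact₁, surj₁⟩, inj₂, exact₂, surj₂⟩ := h
  obtain ⟨e₁, e₂, ha, hb⟩ := hN
  let e : Hom N N' := ⟨e₁, e₂, LinearMap.ext ha, LinearMap.ext hb⟩
  exact ⟨e.comp g,
    ⟨inj₁, exact₁.comp_injective _ e₁.injective (map_zero e₁), e₁.surjective.comp surj₁⟩,
    ⟨inj₂, exact₂.comp_injective _ e₂.injective (map_zero e₂), e₂.surjective.comp surj₂⟩⟩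

theorem IsShortExact.dimVec_eq (h : IsShortExact f g) : N.dimVec = M.dimVec - L.dimVec := by
  obtain ⟨⟨inj₁, exact₁, surj₁⟩, inj₂, exact₂, surj₂⟩ := h
  have h₁ := finrank_eq_add_finrank_range_of_exact inj₁ exact₁
  have h₂ := finrank_eq_add_finrank_range_of_exact inj₂ exact₂
  rw [LinearMap.range_eq_top.2 surj₁, finrank_top] at h₁
  rw [LinearMap.range_eq_top.2 surj₂, finrank_top] at h₂
  simp only [dimVec, h₁, h₂, Nat.cast_add, Prod.mk_sub_mk, add_sub_cancel_left]

theorem dimVec_P_sub (n m : ℕ) :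
    (P k m).dimVec - (P k n).dimVec = ((m : ℤ) - n, (m : ℤ) - n) := by
  simp only [dimVec, finrank_P₁, finrank_P₂, Nat.cast_add, Prod.mk_sub_mk, add_sub_add_right_eq_sub]

end ShortExact

section Cokernel

variable {k : Type u} [Field k] {m n : ℕ}

/-- The morphism from `Pₘ` to `R_x(t)` at an affine point given by reduction of polynomials. -/
noncomputable def homAffine (m : ℕ) (𝔪 : MaximalSpectrum k[X]) (t : ℕ) :
    Hom (P k m) (R (.affine 𝔪) t) where
  φ₁ := (Ideal.Quotient.mkₐ k (𝔪.asIdeal ^ t)).toLinearMap ∘ₗ toPoly (m + 1)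
  φ₂ := (Ideal.Quotient.mkₐ k (𝔪.asIdeal ^ t)).toLinearMap ∘ₗ toPoly m
  comm_a := LinearMap.ext fun v =>
    congrArg (Ideal.Quotient.mk (𝔪.asIdeal ^ t)) (toPoly_upperBlock_mulVec v)
  comm_b := LinearMap.ext fun v =>
    (congrArg (Ideal.Quotient.mk (𝔪.asIdeal ^ t)) (toPoly_lowerBlock_mulVec v)).trans
      (map_mul _ _ _)

/-- The reduction morphism from `Pₘ` to `R_x(t)`. At infinity, where `R_x(t)` is the module at the
origin with its structure maps interchanged, polynomials are reversed before they are reduced. -/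
noncomputable def homR (m : ℕ) : ∀ (x : ClosedPoint k) (t : ℕ), Hom (P k m) (R x t)
  | .affine 𝔪, t => homAffine m 𝔪 t
  | .infty, t => (homAffine m (originIdeal k) t).swap.comp (reverse k m)

theorem mk_toPoly_eq_zero_iff (𝔪 : MaximalSpectrum k[X]) (t : ℕ) (v : Fin n → k) :
    Ideal.Quotient.mk (𝔪.asIdeal ^ t) (toPoly n v) = 0 ↔
      VanishesToOrder (.affine 𝔪) t n (toPoly n v) := by
  rw [Ideal.Quotient.eq_zero_iff_mem, ← span_poly_affine, Ideal.span_singleton_pow,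
    Ideal.mem_span_singleton, VanishesToOrder, ClosedPoint.atInfty, zero_mul, Nat.sub_zero]
  exact (and_iff_left (toPoly_mem_degreeLT v)).symm

theorem mk_toPoly_rev_eq_zero_iff (t : ℕ) (v : Fin n → k) :
    Ideal.Quotient.mk ((originIdeal k).asIdeal ^ t) (toPoly n (v ∘ Fin.rev)) = 0 ↔
      VanishesToOrder .infty t n (toPoly n v) := by
  rw [Ideal.Quotient.eq_zero_iff_mem, originIdeal, Ideal.span_singleton_pow,
    Ideal.mem_span_singleton, X_pow_dvd_toPoly_rev_iff, VanishesToOrder, ClosedPoint.atInfty,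
    ClosedPoint.poly, one_mul, one_pow]
  exact (and_iff_right (one_dvd _)).symm

theorem homR_φ₁_eq_zero_iff (x : ClosedPoint k) (t : ℕ) (v : Fin (m + 1) → k) :
    (homR m x t).φ₁ v = 0 ↔ VanishesToOrder x t (m + 1) (toPoly (m + 1) v) := by
  cases x with
  | affine 𝔪 => exact mk_toPoly_eq_zero_iff 𝔪 t v
  | infty => exact mk_toPoly_rev_eq_zero_iff t v

theorem homR_φ₂_eq_zero_iff (x : ClosedPoint k) (t : ℕ) (v : Fin m → k) :
    (homR m x t).φ₂ v = 0 ↔ VanishesToOrder x t m (toPoly m v) := by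
  cases x with
  | affine 𝔪 => exact mk_toPoly_eq_zero_iff 𝔪 t v
  | infty => exact mk_toPoly_rev_eq_zero_iff t v

theorem injective_exact_surjective_of_toPoly_eq_mul {r : ℕ} {x : Fin r → ClosedPoint k}
    (hx : Function.Injective x) (t : Fin r → ℕ) {F : k[X]}
    (hF : Associated F (∏ i, (x i).poly ^ t i))
    (hm : n + F.natDegree + ∑ i, (x i).atInfty * t i = m)
    {f : (Fin n → k) →ₗ[k] (Fin m → k)} (hf : ∀ v, toPoly m (f v) = F * toPoly n v)
    {W : Fin r → Type*} [∀ i, AddCommGroup (W i)] [∀ i, Module k (W i)]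
    [∀ i, Module.Finite k (W i)] {g : ∀ i, (Fin m → k) →ₗ[k] W i}
    (hg : ∀ i v, g i v = 0 ↔ VanishesToOrder (x i) (t i) m (toPoly m v))
    (hW : ∀ i, finrank k (W i) = finrank k (R (x i) (t i)).V₁) :
    Function.Injective f ∧ Function.Exact f (LinearMap.pi g) ∧
      Function.Surjective (LinearMap.pi g) := by
  have hF0 : F ≠ 0 := hF.ne_zero_iff.2 (prod_poly_pow_ne_zero x t)
  have injective : Function.Injective f := fun v w h => toPoly_injective n
    (mul_left_cancel₀ hF0 (by rw [← hf, ← hf, h]))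
  have exact : Function.Exact f (LinearMap.pi g) := fun v => calc
    LinearMap.pi g v = 0 ↔ ∀ i, VanishesToOrder (x i) (t i) m (toPoly m v) :=
      funext_iff.trans (forall_congr' fun i => hg i v)
    _ ↔ ∃ w, F * toPoly n w = toPoly m v :=
      forall_vanishesToOrder_iff hx t hF hm (toPoly_mem_degreeLT v)
    _ ↔ v ∈ Set.range f := by simp only [← hf, (toPoly_injective m).eq_iff, Set.mem_range]
  have finrank_W : finrank k (∀ i, W i) = F.natDegree + ∑ i, (x i).atInfty * t i := by
    rw [finrank_pi_fintype, ← sum_finrank_R x t hF]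
    exact Finset.sum_congr rfl fun i _ => hW i
  have finrank_range := finrank_eq_add_finrank_range_of_exact injective exact
  rw [finrank_fin_fun, finrank_fin_fun] at finrank_range
  exact ⟨injective, exact,
    LinearMap.range_eq_top.1 (Submodule.eq_top_of_finrank_eq (by omega))⟩

theorem exists_isShortExact {r : ℕ} {x : Fin r → ClosedPoint k}
    (hx : Function.Injective x) (t : Fin r → ℕ) {F : k[X]}
    (hF : Associated F (∏ i, (x i).poly ^ t i))
    (hm : n + F.natDegree + ∑ i, (x i).atInfty * t i = m) {f : Hom (P k n) (P k m)}
    (hf₁ : ∀ v, toPoly (m + 1) (f.φ₁ v) = F * toPoly (n + 1) v)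
    (hf₂ : ∀ v, toPoly m (f.φ₂ v) = F * toPoly n v) :
    ∃ g : Hom (P k m) (directSum fun i => R (x i) (t i)), IsShortExact f g :=
  ⟨Hom.pi fun i => homR m (x i) (t i),
    injective_exact_surjective_of_toPoly_eq_mul hx t hF (by omega) hf₁
      (fun i v => homR_φ₁_eq_zero_iff (x i) (t i) v) fun _ => rfl,
    injective_exact_surjective_of_toPoly_eq_mul hx t hF hm hf₂
      (fun i v => homR_φ₂_eq_zero_iff (x i) (t i) v)
      fun i => (finrank_R₁_eq_finrank_R₂ (x i) (t i)).symm⟩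

theorem IsShortExact.isRegular {M : KroneckerModule k} {f : Hom (P k n) (P k m)}
    {g : Hom (P k m) M} (h : IsShortExact f g) : M.IsRegular := by
  obtain ⟨F, hf₁, hf₂⟩ := f.exists_toPoly_eq_mul
  have hF : F ≠ 0 := by
    rintro rfl
    have f_eq_zero (v : Fin (n + 1) → k) : f.φ₁ v = 0 :=
      toPoly_injective (m + 1) ((hf₁ v).trans ((zero_mul _).trans (map_zero _).symm))
    exact one_ne_zero (congrFun (h.1.1 ((f_eq_zero 1).trans (map_zero f.φ₁).symm)) 0)
  have hdeg := add_natDegree_le_of_toPoly_eq_mul hF hf₁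
  obtain ⟨r, x, t, hx, ht, h_prod, h_sum⟩ :=
    exists_associated_prod hF (Nat.le_sub_of_add_le' hdeg)
  obtain ⟨g', hg'⟩ := exists_isShortExact hx t h_prod (by omega) hf₁ hf₂
  exact ⟨r, _, fun i => isRegularIndecomposable_R (x i) (ht i), h.isIso hg'⟩

theorem exists_isShortExact_of_isRegular {M : KroneckerModule k}
    (hM : M.IsRegular) (hd : M.dimVec = (P k m).dimVec - (P k n).dimVec)
    (ht : M.SummandsInDistinctTubes) :
    ∃ (f : Hom (P k n) (P k m)) (g : Hom (P k m) M), IsShortExact f g := by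
  rw [dimVec_P_sub] at hd
  have hd₁ : (finrank k M.V₁ : ℤ) = m - n := congrArg Prod.fst hd
  have hd₂ : (finrank k M.V₂ : ℤ) = m - n := congrArg Prod.snd hd
  obtain ⟨r, Y, hY, hMY⟩ := hM
  choose x hx using hMY.exists_inTube_of_finrank_eq hY (by omega)
  have x_injective : Function.Injective x := fun i j hij => by_contra fun hne =>
    ht r Y (fun i => (hY i).1) hMY i j hne (x i) (x j) (hx i) (hx j) hij
  choose t _ hYR using hx
  have hMR : M.IsIso (directSum fun i => R (x i) (t i)) := hMY.trans (IsIso.directSum hYR)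
  let F : k[X] := ∏ i, (x i).poly ^ t i
  have hF : Associated F (∏ i, (x i).poly ^ t i) := Associated.refl F
  have h_deg : n + F.natDegree + ∑ i, (x i).atInfty * t i = m := by
    have h_sum := sum_finrank_R x t hF
    rw [← finrank_directSum₁, ← hMR.finrank₁] at h_sum
    omega
  obtain ⟨f, hf₁, hf₂⟩ := exists_hom_toPoly_eq_mul (F := F) (n := n) (m := m) (by omega)
  obtain ⟨g, hg⟩ := exists_isShortExact x_injective t hF h_deg hf₁ hf₂
  exact ⟨f, hg.exists_of_isIso hMR.symm⟩

end Cokernel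

end KroneckerModule

theorem mainTheorem8 {k : Type*} [Field k] (n m : ℕ) (hnm : n < m) (X : KroneckerModule k) :
    (∃ (f : KroneckerModule.Hom (KroneckerModule.P k n) (KroneckerModule.P k m))
        (g : KroneckerModule.Hom (KroneckerModule.P k m) X),
        KroneckerModule.IsShortExact f g) ↔
      (X.IsRegular ∧
          X.dimVec = (KroneckerModule.P k m).dimVec - (KroneckerModule.P k n).dimVec) ∧
        X.SummandsInDistinctTubes := by
  constructor
  · rintro ⟨f, g, h⟩
    exact ⟨⟨h.isRegular, h.dimVec_eq⟩,
      KroneckerModule.summandsInDistinctTubes_of_surjective g h.1.2.2⟩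
  · rintro ⟨⟨hreg, hdim⟩, htubes⟩
    exact KroneckerModule.exists_isShortExact_of_isRegular hreg hdim htubes
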